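/- Let $n\ge 2$, let $E=\{(i,j): 1\le i<j\le n\}$ be the edge set of the complete graph $K_n$, and let $a_e$ ($e\in E$) be indeterminates. Put $a_S=\sum_{e\in S}a_e$ for $S\subseteq E$, $R_0=\mathbb Z[a_e: e\in E]/(a_E)$ and $Q_0=\mathrm{Frac}(R_0)$. **Amplitude.** Let $M=M(K_n)$ be the graphic matroid of $K_n$, of rank $r=n-1$, oriented by the braid arrangement: the signed covectors are the sign vectors $\big(\mathrm{sign}(z_j-z_i)\big)_{(i,j)\in E}$, $z\in\mathbb R^n$, and a chirotope $\chi$ (one of the two possible) is fixed. Let $P_{\mathrm{id}}$ be the tope with all signs $+$, i.e. the chamber $z_1<z_2<\dots<z_n$. For a matroid $N$ let $A^\bullet(N)$ be its Orlik–Solomon algebra over $\mathbb Z$, the quotient of the exterior algebra on generators $e$ in the ground set by the ideal generated by the $\partial e_S$, $S$ dependent, where $\partial(e_1\wedge\dots\wedge e_k)=\sum_i(-1)^{k-i}e_1\wedge\dots\widehat{e_i}\dots\wedge e_k$. For an atom $c$ of the lattice of flats of a loopless $N$, let $\mathrm{Res}_c:A^\bullet(N)\to A^{\bullet-1}(N/c)$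 be the residue map: it sends $e_{i_{k-1}}\wedge\dots\wedge e_{i_1}\wedge e$ to $e_{i_{k-1}}\wedge\dots\wedge e_{i_1}$ if $e$ is the only factor in $c$, and kills monomials with no factor, or several factors, in $c$. For a saturated flag of flats $F_\bullet=(\hat 0=F_0\subset F_1\subset\dots\subset F_k)$ with $\mathrm{rk}\,F_i=i$ let $\mathrm{Res}_{F_\bullet}=\mathrm{Res}_{F_k/F_{k-1}}\circ\dots\circ\mathrm{Res}_{F_1}:A^k(N)\to A^0(N/F_k)\cong\mathbb Z$. The canonical form $\Omega_P\in A^{r}(N)$ of a tope $P$ of an oriented matroid of rank $r$ with underlying matroid $N$ and chirotope $\chi$ is determined by the recursion: $\Omega_P=\chi(\emptyset)$ if $r=0$; if $r\geq 1$, then for every atom $c$ and $e\in c$ one has $\mathrm{Res}_c\Omega_P=P(e)\,\Omega_{P/c}$ if $c$ is the zero set of a covector obtained from $P$ by setting some entries to $0$, and $\mathrm{Res}_c\Omega_P=0$ otherwise, where $P/c$ is the restriction of $P$ to the complement of $c$, and the contraction by $c$ carries the chirotope $(e_1,\dots,e_{r-1})\mapsto\chi(e_1,\dots,e_{r-1},e)$.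 The $(n+1)$-point planar $\phi^3$ (biadjoint scalar) amplitude is the deRham intersection number of $\Omega_{P_{\mathrm{id}}}\in A^{n-1}(M)$ with itself, $$A_{n+1}^{\phi^3}=\mathcal A(P_{\mathrm{id}})=\sum_{F_\bullet}\mathrm{Res}_{F_\bullet}(\Omega_{P_{\mathrm{id}}})\Big(\prod_{i=1}^{n-2}\frac1{a_{F_i}}\Big)\mathrm{Res}_{F_\bullet}(\Omega_{P_{\mathrm{id}}})\in Q_0,$$ the sum being over all saturated flags of flats of $M$ of length $n-1$. **Temporal Feynman diagrams.** A cubic planar tree $T$ on $[n+1]$ is a planarly embedded tree with leaves labelled $1,\dots,n+1$ in cyclic order and all other vertices of degree three. Let $I(T)$ be the set of its internal edges (those not incident to a leaf), write $e\preceq e'$ if the path from $e$ to the leaf $n+1$ passes through $e'$, and let $S_e\subseteq[n]$ be the set of leaves in the component of $T\setminus e$ not containing $n+1$. A temporal Feynman diagram is a pair $(T,\le)$ of a cubic planar tree $T$ on $[n+1]$ and a total order $\le$ on $I(T)$ such that $e\preceq e'$ implies $e\le e'$. For $e\in I(T)$ let $D(e)$ be the set of $\preceq$-maximal elements of $\{e'\in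 I(T): e'\le e\}$, let $F_\le(e)=\bigcup_{e'\in D(e)}\{(i,j)\in E: i,j\in S_{e'}\}$, and let $$Y_e=\sum_{(i,j)\in F_\le(e)}a_{(i,j)}$$ be the temporal propagator. **Theorem.** In $Q_0$, $$A_{n+1}^{\phi^3}=\sum_{(T,\le)}\ \prod_{e\in I(T)}\frac1{Y_e},$$ the sum being over all temporal Feynman diagrams $(T,\le)$ on $[n+1]$. -/

import Mathlib

open scoped BigOperators Matroid
open CliffordAlgebra (contractRight involute)

noncomputable section

namespace MatroidAmplitude

variable {α : Type*}

/-! ## The Orlik–Solomon algebra -/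

/-- The exterior algebra over `ℤ` on generators indexed by `α`. -/
abbrev Ext (α : Type*) : Type _ := ExteriorAlgebra ℤ (α →₀ ℤ)

/-- The generator of the exterior algebra attached to `e`. -/
def gen (e : α) : Ext α := ExteriorAlgebra.ι ℤ (Finsupp.single e 1)

/-- `e_S = e_{s_k} ∧ ⋯ ∧ e_{s_1}` for an ordered tuple `S = (s_1, …, s_k)`. -/
def extMonomial (S : List α) : Ext α := (S.reverse.map gen).prod

open Classical in
/-- The linear functional on the span of the generators that is `1` on the elements of `c` and
`0` on all other generators. -/
def indicatorFunctional (c : Set α) : Module.Dual ℤ (α →₀ ℤ) :=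
  Finsupp.linearCombination ℤ (fun e => if e ∈ c then (1 : ℤ) else 0)

/-- The derivation
`∂ (e_1 ∧ ⋯ ∧ e_k) = ∑ i, (-1)^(k-i) e_1 ∧ ⋯ ∧ ê_i ∧ ⋯ ∧ e_k`, that is, contraction from the
right with the functional that sends every generator to `1`. -/
def extBoundary : Ext α →ₗ[ℤ] Ext α := contractRight.flip (indicatorFunctional Set.univ)

/-- The ideal of relations of the Orlik–Solomon algebra of `M`: it contains `∂ e_S` for every
dependent set `S`.  All matroids on subsets of `α` (in particular all minors of `M`) use the same
exterior algebra, so the generators outside the ground set are set to zero. -/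
def osTwoSidedIdeal (M : Matroid α) : TwoSidedIdeal (Ext α) :=
  TwoSidedIdeal.span
    ({x | ∃ e, e ∉ M.E ∧ x = gen e} ∪
      {x | ∃ S : List α, S.Nodup ∧ M.Dep {e | e ∈ S} ∧ x = extBoundary (extMonomial S)})

/-- The ideal of relations, seen as a `ℤ`-submodule. -/
def osIdeal (M : Matroid α) : Submodule ℤ (Ext α) :=
  (osTwoSidedIdeal M).asIdeal.restrictScalars ℤ

/-- The Orlik–Solomon algebra `A^•(M)`, of which only the structure of `ℤ`-module is needed. -/
abbrev OS (M : Matroid α) : Type _ := Ext α ⧸ osIdeal M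

/-- The class of an element of the exterior algebra in `A^•(M)`. -/
def osMk (M : Matroid α) : Ext α →ₗ[ℤ] OS M := (osIdeal M).mkQ

/-- The homogeneous component `A^k(M)`. -/
def osDegree (M : Matroid α) (k : ℕ) : Submodule ℤ (OS M) :=
  (⋀[ℤ]^k (α →₀ ℤ)).map (osMk M)

/-! ## Residue maps -/

open Classical in
/-- The algebra endomorphism of the exterior algebra that sends the generators in `c` to zero and
fixes all other generators. -/
def killGens (c : Set α) : Ext α →ₐ[ℤ] Ext α :=
  ExteriorAlgebra.map
    (Finsupp.linearCombination ℤ (fun e => if e ∈ c then 0 else Finsupp.single e (1 : ℤ)))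

/-- The residue along `c` on the exterior algebra.  With `e_I = e_{i_{k-1}} ∧ ⋯ ∧ e_{i_1} ∧ e` for
`I = (e, i_1, …, i_{k-1})`, it sends `e_I` to `e_{i_{k-1}} ∧ ⋯ ∧ e_{i_1}` if `e` is the only
element of `I` in `c`, and to `0` if `I` contains no element, or several elements, of `c`. -/
def extResidue (c : Set α) : Ext α →ₗ[ℤ] Ext α :=
  (killGens c).toLinearMap ∘ₗ contractRight.flip (indicatorFunctional c)

theorem indicatorFunctional_single_of_mem {c : Set α} {e : α} (h : e ∈ c) :
    indicatorFunctional c (Finsupp.single e 1) = 1 := by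
  simp [indicatorFunctional, h]

theorem indicatorFunctional_single_of_notMem {c : Set α} {e : α} (h : e ∉ c) :
    indicatorFunctional c (Finsupp.single e 1) = 0 := by
  simp [indicatorFunctional, h]

theorem killGens_gen_of_mem {c : Set α} {e : α} (h : e ∈ c) : killGens c (gen e) = 0 := by
  simp [killGens, gen, h]

theorem killGens_gen_of_notMem {c : Set α} {e : α} (h : e ∉ c) :
    killGens c (gen e) = gen e := by
  simp [killGens, gen, h]

theorem contract_mul_gen (d : Module.Dual ℤ (α →₀ ℤ)) (x : Ext α) (e : α) :
    contractRight (x * gen e) d = d (Finsupp.single e 1) • x - contractRight x d * gen e :=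
  CliffordAlgebra.contractRight_mul_ι _ _ _ 

theorem involute_gen (e : α) : involute (gen e) = -gen e := CliffordAlgebra.involute_ι _

theorem contract_ι_mul (d : Module.Dual ℤ (α →₀ ℤ)) (x : Ext α) (w : α →₀ ℤ) :
    contractRight (ExteriorAlgebra.ι ℤ w * x) d = d w • involute x +
      ExteriorAlgebra.ι ℤ w * contractRight x d := by
  induction x using CliffordAlgebra.right_induction with
  | algebraMap r =>
    rw [CliffordAlgebra.contractRight_mul_algebraMap]
    erw [CliffordAlgebra.contractRight_ι]
    rw [CliffordAlgebra.contractRight_algebraMap, mul_zero, add_zero,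
      AlgHom.commutes, Algebra.smul_def]
  | add x y hx hy =>
    rw [mul_add, map_add, LinearMap.add_apply, hx, hy, map_add, map_add, LinearMap.add_apply]
    simp only [smul_add, mul_add]; abel
  | mul_ι v x hx =>
    rw [← mul_assoc, CliffordAlgebra.contractRight_mul_ι, hx, CliffordAlgebra.contractRight_mul_ι,
      map_mul, CliffordAlgebra.involute_ι]
    simp only [add_mul, mul_sub, mul_neg, smul_neg, mul_smul_comm, smul_mul_assoc, mul_assoc]
    abel

theorem contract_gen_mul (d : Module.Dual ℤ (α →₀ ℤ)) (x : Ext α) (e : α) :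
    contractRight (gen e * x) d = d (Finsupp.single e 1) • involute x +
      gen e * contractRight x d := contract_ι_mul d x _

theorem involute_contract (d : Module.Dual ℤ (α →₀ ℤ)) (x : Ext α) :
    involute (contractRight x d) = -contractRight (involute x) d := by
  induction x using CliffordAlgebra.right_induction with
  | algebraMap r =>
    rw [CliffordAlgebra.contractRight_algebraMap, AlgHom.commutes,
      CliffordAlgebra.contractRight_algebraMap, map_zero, neg_zero]
  | add x y hx hy => simp only [map_add, LinearMap.add_apply, hx, hy]; abel
  | mul_ι v x hx => 
    rw [CliffordAlgebra.contractRight_mul_ι, map_sub, map_mul, hx, map_mul,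
      CliffordAlgebra.involute_ι, mul_neg, mul_neg, map_neg, LinearMap.neg_apply,
      CliffordAlgebra.contractRight_mul_ι, map_smul, neg_mul]
    abel
    
theorem gen_mul_self (e : α) : gen e * gen e = 0 := ExteriorAlgebra.ι_sq_zero _

theorem gen_mul_gen (e f : α) : gen e * gen f = -(gen f * gen e) :=
  eq_neg_of_add_eq_zero_left (ExteriorAlgebra.ι_add_mul_swap _ _)

theorem prod_gen_perm {l l' : List α} (h : l.Perm l') :
    (l'.map gen).prod = (l.map gen).prod ∨ (l'.map gen).prod = -(l.map gen).prod := by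
  induction h with
  | nil => simp
  | cons x _ ih => rcases ih with ih | ih <;> simp [ih]
  | swap x y l =>
    right
    simp only [List.map_cons, List.prod_cons, ← mul_assoc]
    rw [gen_mul_gen x y, neg_mul]
  | trans _ _ ih1 ih2 =>
    rcases ih1 with h1 | h1 <;> rcases ih2 with h2 | h2 <;> simp [h1, h2]

theorem involute_prod_gen (l : List α) :
    involute (l.map gen).prod = (-1 : ℤ) ^ l.length • (l.map gen).prod := by
  have := CliffordAlgebra.involute_prod_map_ι (Q := (0 : QuadraticForm ℤ (α →₀ ℤ)))
    (l.map fun e => Finsupp.single e (1 : ℤ))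
  rw [List.map_map, List.length_map] at this
  exact this

theorem killGens_prod_of_disjoint (c : Set α) (l : List α) (h : ∀ e ∈ l, e ∉ c) :
    killGens c (l.map gen).prod = (l.map gen).prod := by
  induction l with
  | nil => simp
  | cons a l ih =>
    simp only [List.map_cons, List.prod_cons, map_mul]
    rw [ih fun e he => h e (List.mem_cons_of_mem _ he),
      killGens_gen_of_notMem (h a List.mem_cons_self)]

theorem contract_prod_of_disjoint (c : Set α) (l : List α) (h : ∀ e ∈ l, e ∉ c) :
    contractRight (l.map gen).prod (indicatorFunctional c) = 0 := by
  induction l with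
  | nil => simp
  | cons a l ih =>
    simp only [List.map_cons, List.prod_cons]
    rw [contract_gen_mul, ih fun e he => h e (List.mem_cons_of_mem _ he),
      indicatorFunctional_single_of_notMem (h a List.mem_cons_self)]
    simp

/-- `∂` maps a monomial in generators outside `c` to an element fixed by `killGens c`. -/
theorem killGens_boundary_of_disjoint (c : Set α) (l : List α) (h : ∀ e ∈ l, e ∉ c) :
    killGens c (extBoundary (l.map gen).prod) = extBoundary (l.map gen).prod := by
  induction l with
  | nil => simp [extBoundary]
  | cons a l ih =>
    simp only [List.map_cons, List.prod_cons, extBoundary, LinearMap.flip_apply] at ih ⊢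
    have hl : ∀ e ∈ l, e ∉ c := fun e he => h e (List.mem_cons_of_mem _ he)
    rw [contract_gen_mul, map_add, map_mul, ih hl, map_smul, involute_prod_gen, map_smul,
      killGens_prod_of_disjoint c l hl, killGens_gen_of_notMem (h a List.mem_cons_self)]

theorem boundary_prod_mem (M : Matroid α) (l : List α) (hl : l.Nodup)
    (hd : M.Dep {e | e ∈ l}) : extBoundary (l.map gen).prod ∈ osTwoSidedIdeal M := by
  apply TwoSidedIdeal.subset_span
  right
  exact ⟨l.reverse, by simpa using hl, by simpa using hd, by simp [extMonomial]⟩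

theorem smul_mem_os {M : Matroid α} (n : ℤ) {x : Ext α} (h : x ∈ osTwoSidedIdeal M) :
    n • x ∈ osTwoSidedIdeal M := (osIdeal M).smul_mem n h

theorem prod_mem (M : Matroid α) (l : List α) (hl : l.Nodup) (hne : l ≠ [])
    (hd : M.Dep {e | e ∈ l}) : (l.map gen).prod ∈ osTwoSidedIdeal M := by
  have hb := boundary_prod_mem M l hl hd
  obtain ⟨l', a, rfl⟩ : ∃ l' a, l = l' ++ [a] := 
    ⟨l.dropLast, l.getLast hne, (List.dropLast_append_getLast hne).symm⟩
  have h2 := (osTwoSidedIdeal M).mul_mem_right _ (gen a) hb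
  simp only [List.map_append, List.prod_append, List.map_cons, List.map_nil, List.prod_cons,
    List.prod_nil, mul_one, extBoundary, LinearMap.flip_apply] at h2 ⊢
  rw [contract_mul_gen, indicatorFunctional_single_of_mem (Set.mem_univ a), one_smul, sub_mul,
    mul_assoc, gen_mul_self, mul_zero, sub_zero] at h2
  exact h2

theorem dep_contract {M : Matroid α} [M.Loopless] {c : Set α} (hc : c ⊆ M.E) {S : Set α} {e : α}
    (he : e ∈ c) (hSc : Disjoint S c) (hd : M.Dep (insert e S)) : (M ／ c).Dep S := by
  have hS : S ⊆ M.E := (Set.subset_insert _ _).trans hd.subset_ground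
  refine ⟨fun hi => hd.not_indep ?_, by
    rw [Matroid.contract_ground]; exact fun x hx => ⟨hS hx, fun h => hSc.ne_of_mem hx h rfl⟩⟩
  have hn : M.Indep {e} := (M.isNonloop_of_loopless (hc he)).indep
  obtain ⟨I, hI, heI⟩ := hn.subset_isBasis_of_subset (Set.singleton_subset_iff.2 he) hc
  refine ((hI.contract_indep_iff.1 hi).1).subset ?_
  rintro x (rfl | hx)
  · exact Or.inr (heI rfl)
  · exact Or.inl hx

theorem dep_contract' {M : Matroid α} {c : Set α} {S : Set α} 
    (hSc : Disjoint S c) (hd : M.Dep S) : (M ／ c).Dep S :=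
  ⟨fun hi => hd.not_indep hi.of_contract, by
    rw [Matroid.contract_ground]
    exact fun x hx => ⟨hd.subset_ground hx, fun h => hSc.ne_of_mem hx h rfl⟩⟩

theorem killGens_boundary_mem {M : Matroid α} [M.Loopless] {c : Set α} (hc : c ⊆ M.E)
    (S : List α) (hS : S.Nodup) (hd : M.Dep {e | e ∈ S}) :
    killGens c (extBoundary (extMonomial S)) ∈ osTwoSidedIdeal (M ／ c) ∧
    killGens c (contractRight (extBoundary (extMonomial S)) (indicatorFunctional c)) ∈
      osTwoSidedIdeal (M ／ c) := by
  classical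
  set J := osTwoSidedIdeal (M ／ c) with hJ
  set t := S.filter (fun e => e ∉ c) with ht
  set s := S.filter (fun e => e ∈ c) with hs
  have htc : ∀ e ∈ t, e ∉ c := by simp [ht]
  have hsc : ∀ e ∈ s, e ∈ c := by simp [hs]
  have hperm : S.reverse.Perm (t ++ s) := by
    refine (List.reverse_perm S).trans ?_
    have := List.filter_append_perm (fun e => decide (e ∈ c)) S
    refine (List.Perm.trans ?_ this).symm
    rw [ht, hs]
    simpa using List.perm_append_comm
  have htn : t.Nodup := hS.filter _
  have hdisj : Disjoint {e | e ∈ t} c := Set.disjoint_left.2 htc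
  suffices h : killGens c (extBoundary ((t ++ s).map gen).prod) ∈ J ∧
      killGens c (contractRight (extBoundary ((t ++ s).map gen).prod) (indicatorFunctional c)) ∈ J by
    rcases prod_gen_perm hperm with h' | h'
    · rw [extMonomial, ← h']; exact h
    · have h'' : extMonomial S = -((t ++ s).map gen).prod := by rw [h', neg_neg]; rfl
      rw [h'', map_neg, map_neg, map_neg, LinearMap.neg_apply, map_neg]
      exact ⟨J.neg_mem h.1, J.neg_mem h.2⟩
  have hset : {e | e ∈ S} = {e | e ∈ t ++ s} := by
    ext e; exact (List.mem_reverse.symm.trans hperm.mem_iff)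
  rw [hset] at hd
  clear_value t s
  have hcomm : ∀ x : Ext α, contractRight (extBoundary x) (indicatorFunctional c) =
      -extBoundary (contractRight x (indicatorFunctional c)) := fun x =>
    CliffordAlgebra.contractRight_comm _ _ _
  have hbd : ∀ (x : Ext α) (e : α), extBoundary (x * gen e) = x - extBoundary x * gen e := by
    intro x e
    simp only [extBoundary, LinearMap.flip_apply]
    rw [contract_mul_gen, indicatorFunctional_single_of_mem (Set.mem_univ e), one_smul]
  have hcd : ∀ (x : Ext α) (e : α), e ∈ c → contractRight (x * gen e) (indicatorFunctional c) =
      x - contractRight x (indicatorFunctional c) * gen e := by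
    intro x e he
    rw [contract_mul_gen, indicatorFunctional_single_of_mem he, one_smul]
  rcases List.eq_nil_or_concat s with rfl | ⟨s', e, rfl⟩
  · rw [hcomm]
    simp only [List.append_nil] at hd ⊢
    rw [contract_prod_of_disjoint c t htc, killGens_boundary_of_disjoint c t htc]
    refine ⟨boundary_prod_mem _ _ htn (dep_contract' hdisj hd), ?_⟩
    simp [J.zero_mem]
  have he : e ∈ c := hsc e (by simp)
  rcases List.eq_nil_or_concat s' with rfl | ⟨s'', f, rfl⟩
  · have hd' : (M ／ c).Dep {x | x ∈ t} := by
      refine dep_contract hc he hdisj ?_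
      convert hd using 1
      ext x; simp [or_comm]
    have hne : t ≠ [] := by
      rintro rfl
      exact hd'.not_indep (by simp)
    rw [hcomm]
    simp only [List.concat_eq_append, List.nil_append, List.map_append, List.prod_append,
      List.map_cons, List.map_nil, List.prod_cons, List.prod_nil, mul_one]
    rw [hbd, hcd _ _ he, contract_prod_of_disjoint c t htc, zero_mul, sub_zero, map_neg,
      killGens_boundary_of_disjoint c t htc, map_sub, map_mul, killGens_gen_of_mem he, mul_zero,
      sub_zero, killGens_prod_of_disjoint c t htc]
    exact ⟨prod_mem _ _ htn hne hd', J.neg_mem (boundary_prod_mem _ _ htn hd')⟩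
  · have hf : f ∈ c := hsc f (by simp)
    have hform : ((t ++ ((s''.concat f).concat e)).map gen).prod =
        ((t ++ s'').map gen).prod * gen f * gen e := by
      simp [mul_assoc]
    rw [hform, hcomm]
    generalize ((t ++ s'').map gen).prod = y
    have h1 : killGens c (extBoundary (y * gen f * gen e)) = 0 := by
      rw [hbd, map_sub, map_mul, map_mul, killGens_gen_of_mem he, killGens_gen_of_mem hf]
      simp
    have h2 : killGens c (extBoundary (contractRight (y * gen f * gen e)
        (indicatorFunctional c))) = 0 := by
      rw [hcd _ _ he, hcd _ _ hf, sub_mul]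
      simp only [map_sub, hbd, map_mul, killGens_gen_of_mem he, killGens_gen_of_mem hf, mul_zero,
        sub_zero, sub_self]
    rw [map_neg, h1, h2, neg_zero]
    exact ⟨J.zero_mem, J.zero_mem⟩

theorem extResidue_mem {M : Matroid α} [M.Loopless] {c : Set α} (hc : c ⊆ M.E) {z : Ext α}
    (hz : z ∈ osIdeal M) : extResidue c z ∈ osIdeal (M ／ c) := by
  set J := osTwoSidedIdeal (M ／ c) with hJ
  let P : Ext α → Prop := fun z =>
    killGens c z ∈ J ∧ killGens c (involute z) ∈ J ∧ extResidue c z ∈ J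
  have hadd : ∀ x y, P x → P y → P (x + y) := by
    rintro x y ⟨h1, h2, h3⟩ ⟨h4, h5, h6⟩
    refine ⟨?_, ?_, ?_⟩
    · rw [map_add]; exact J.add_mem h1 h4
    · rw [map_add, map_add]; exact J.add_mem h2 h5
    · rw [map_add]; exact J.add_mem h3 h6
  have hsmul : ∀ (n : ℤ) x, P x → P (n • x) := by
    rintro n x ⟨h1, h2, h3⟩
    refine ⟨?_, ?_, ?_⟩
    · rw [map_zsmul]; exact smul_mem_os n h1
    · rw [map_zsmul, map_zsmul]; exact smul_mem_os n h2
    · rw [map_zsmul]; exact smul_mem_os n h3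
  have hleft : ∀ w x, P x → P (w * x) := by
    intro w
    induction w using CliffordAlgebra.induction with
    | algebraMap r => intro x hx; rw [← Algebra.smul_def]; exact hsmul r x hx
    | add a b ha hb => intro x hx; rw [add_mul]; exact hadd _ _ (ha x hx) (hb x hx)
    | mul a b ha hb => intro x hx; rw [mul_assoc]; exact ha _ (hb x hx)
    | ι v =>
      rintro x ⟨h1, h2, h3⟩
      refine ⟨?_, ?_, ?_⟩
      · rw [map_mul]; exact J.mul_mem_left _ _ h1
      · rw [map_mul, map_mul]; exact J.mul_mem_left _ _ h2
      · have := contract_ι_mul (indicatorFunctional c) x v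
        change killGens c (contractRight (ExteriorAlgebra.ι ℤ v * x) (indicatorFunctional c)) ∈ J
        rw [this, map_add, map_smul, map_mul]
        exact J.add_mem (smul_mem_os _ h2) (J.mul_mem_left _ _ h3)
  have hright : ∀ w x, P x → P (x * w) := by
    intro w
    induction w using CliffordAlgebra.induction with
    | algebraMap r =>
      intro x hx; rw [← Algebra.commutes, ← Algebra.smul_def]; exact hsmul r x hx
    | add a b ha hb => intro x hx; rw [mul_add]; exact hadd _ _ (ha x hx) (hb x hx)
    | mul a b ha hb => intro x hx; rw [← mul_assoc]; exact hb _ (ha x hx)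
    | ι v =>
      rintro x ⟨h1, h2, h3⟩
      refine ⟨?_, ?_, ?_⟩
      · rw [map_mul]; exact J.mul_mem_right _ _ h1
      · rw [map_mul, map_mul]; exact J.mul_mem_right _ _ h2
      · have := CliffordAlgebra.contractRight_mul_ι (Q := (0 : QuadraticForm ℤ (α →₀ ℤ)))
          (indicatorFunctional c) v x
        change killGens c (contractRight (x * CliffordAlgebra.ι 0 v) (indicatorFunctional c)) ∈ J
        rw [this, map_sub, map_smul, map_mul]
        exact J.sub_mem (smul_mem_os _ h1) (J.mul_mem_right _ _ h3)
  suffices h : P z from h.2.2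
  have hz' : z ∈ osTwoSidedIdeal M := hz
  refine TwoSidedIdeal.span_induction (p := fun x _ => P x) ?_ ?_ ?_ ?_ ?_ ?_ hz'
  · rintro x (⟨e, he, rfl⟩ | ⟨S, hS, hd, rfl⟩)
    · have hec : e ∉ c := fun h => he (hc h)
      have hk : killGens c (gen e) ∈ J := by
        rw [killGens_gen_of_notMem hec]
        exact TwoSidedIdeal.subset_span (Or.inl ⟨e, fun h => he h.1, rfl⟩)
      refine ⟨hk, ?_, ?_⟩
      · rw [involute_gen, map_neg]; exact J.neg_mem hk
      · have : contractRight (gen e) (indicatorFunctional c) = 0 := by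
          rw [← one_mul (gen e), contract_mul_gen, indicatorFunctional_single_of_notMem hec,
            CliffordAlgebra.contractRight_one]
          simp
        change killGens c (contractRight (gen e) (indicatorFunctional c)) ∈ J
        rw [this, map_zero]; exact J.zero_mem
    · obtain ⟨h1, h2⟩ := killGens_boundary_mem hc S hS hd
      refine ⟨h1, ?_, h2⟩
      have : involute (extBoundary (extMonomial S)) =
          -((-1 : ℤ) ^ S.reverse.length • extBoundary (extMonomial S)) := by
        simp only [extBoundary, LinearMap.flip_apply, extMonomial]
        rw [involute_contract, involute_prod_gen, map_smul, LinearMap.smul_apply]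
      rw [this, map_neg, map_zsmul]
      exact J.neg_mem (smul_mem_os _ h1)
  · exact ⟨by simp [J.zero_mem], by simp [J.zero_mem], by simp [J.zero_mem]⟩
  · intro x y _ _ hx hy; exact hadd x y hx hy
  · intro x _ hx; rw [← neg_one_zsmul]; exact hsmul _ _ hx
  · intro a x _ hx; exact hleft a x hx
  · intro b x _ hx; exact hright b x hx

theorem algebraMapInv_eq_zero {M : Matroid α} [M.Loopless] {z : Ext α} (hz : z ∈ osIdeal M) :
    ExteriorAlgebra.algebraMapInv z = 0 := by
  have hg : ∀ e : α, ExteriorAlgebra.algebraMapInv (gen e) = (0 : ℤ) := fun e => by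
    simp [gen, ExteriorAlgebra.algebraMapInv]
  have hz' : z ∈ osTwoSidedIdeal M := hz
  refine TwoSidedIdeal.span_induction
    (p := fun x _ => ExteriorAlgebra.algebraMapInv x = (0 : ℤ)) ?_ ?_ ?_ ?_ ?_ ?_ hz'
  · rintro x (⟨e, he, rfl⟩ | ⟨S, hS, hd, rfl⟩)
    · exact hg e
    · match S, hd with
      | [], hd => exact absurd M.empty_indep (by simpa using hd.not_indep)
      | [e], hd =>
        exact absurd (M.isNonloop_of_loopless (e := e) (hd.subset_ground (by simp))).indep
          (by simpa using hd.not_indep)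
      | e :: f :: S, hd =>
        simp only [extMonomial, extBoundary, List.reverse_cons, List.map_append, List.map_cons,
          List.map_nil, List.prod_append, List.prod_cons, List.prod_nil, mul_one,
          LinearMap.flip_apply, contract_mul_gen]
        simp [hg, indicatorFunctional]
  · simp
  · intro x y _ _ hx hy; rw [map_add, hx, hy, add_zero]
  · intro x _ hx; rw [map_neg, hx, neg_zero]
  · intro a x _ hx; rw [map_mul, hx, mul_zero]
  · intro b x _ hx; rw [map_mul, hx, zero_mul]

open Classical in
/-- The residue map `Res_c : A^•(M) → A^{•-1}(M / c)`; it is well defined as soon as `M` has no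
loops and `c` is contained in the ground set, in particular for an atom `c` of the lattice of
flats. -/
def osResidue (M : Matroid α) (c : Set α) : OS M →ₗ[ℤ] OS (M ／ c) :=
  if h : M.Loopless ∧ c ⊆ M.E then
    (osIdeal M).mapQ (osIdeal (M ／ c)) (extResidue c)
      (fun _ hz => haveI := h.1; extResidue_mem h.2 hz)
  else 0

open Classical in
/-- The projection of `A^•(M)` to `A^0(M) ≅ ℤ`, where `e_∅` is identified with `1`; it is well
defined if `M` has no loops. -/
def osAugmentation (M : Matroid α) : OS M →ₗ[ℤ] ℤ :=
  if h : M.Loopless then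
    (osIdeal M).liftQ (ExteriorAlgebra.algebraMapInv : Ext α →ₐ[ℤ] ℤ).toLinearMap
      (fun _ hz => haveI := h; LinearMap.mem_ker.2 (algebraMapInv_eq_zero hz))
  else 0

/-- `F_0 ⊂ F_1 ⊂ ⋯ ⊂ F_k` is a saturated flag of flats of `M` starting at the minimal flat. -/
structure IsSaturatedFlag (M : Matroid α) (k : ℕ) (F : Fin (k + 1) → Set α) : Prop where
  isFlat : ∀ i, M.IsFlat (F i)
  rank : ∀ i, M.eRk (F i) = ((i : ℕ) : ℕ∞)
  monotone : Monotone F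

/-- The residue `Res_{F_•} = Res_{F_k/F_{k-1}} ∘ ⋯ ∘ Res_{F_2/F_1} ∘ Res_{F_1}` of an element of
degree `k` along a saturated flag of length `k`, as an integer. -/
def flagResidue : (k : ℕ) → (M : Matroid α) → (Fin (k + 1) → Set α) → (OS M →ₗ[ℤ] ℤ)
  | 0, M, _ => osAugmentation M
  | k + 1, M, F =>
    flagResidue k (M ／ F 1) (fun i => F i.succ \ F 1) ∘ₗ osResidue M (F 1)

/-! ## The deRham cohomology intersection form -/

open Classical in
/-- `a_S = ∑_{e ∈ S} a_e`. -/
def setSum [Fintype α] {K : Type*} [AddCommMonoid K] (a : α → K) (S : Set α) : K :=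
  ∑ e with e ∈ S, a e

open Classical in
/-- The deRham cohomology intersection form on `A^k(M)` with parameters `a_e` in a field `K`:
the sum over the saturated flags `F_•` of length `k` of
`Res_{F_•}(x) · ∏_{0 < i < k} 1 / a_{F_i} · Res_{F_•}(y)`. -/
def deRhamForm [Fintype α] {K : Type*} [Field K] (M : Matroid α) (k : ℕ) (a : α → K)
    (x y : osDegree M k) : K :=
  ∑ F : Fin (k + 1) → Set α with IsSaturatedFlag M k F,
    (flagResidue k M F x : K) * (∏ i ∈ Finset.Ioo 0 (Fin.last k), 1 / setSum a (F i)) *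
      (flagResidue k M F y : K)

/-! ## Oriented matroids of arrangements of real hyperplanes, and canonical forms -/

section Arrangement

variable {V : Type*} [AddCommGroup V] [Module ℝ V]

/-- The matroid of the arrangement of the hyperplanes `f_e = 0`: a set is independent when the
linear forms `f_e` are linearly independent. -/
def arrangementMatroid [Finite α] (f : α → Module.Dual ℝ V) : Matroid α :=
  (IndepMatroid.ofFinite (E := Set.univ) Set.finite_univ (fun I => LinearIndepOn ℝ f I)
    (linearIndepOn_empty ℝ f) (fun _ _ hJ hIJ => hJ.mono hIJ)
    (by
      intro I J hI hJ hlt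
      by_contra! hcon
      have hIn : ∀ e ∈ J, f e ∈ Submodule.span ℝ (f '' I) := by
        intro e he
        by_cases heI : e ∈ I
        · exact Submodule.subset_span (Set.mem_image_of_mem f heI)
        · have h := hcon e he heI
          rw [linearIndepOn_insert heI] at h
          by_contra hns
          exact h ⟨hI, hns⟩
      have hle : Set.range (fun e : J => f e) ≤ Submodule.span ℝ (f '' I) := by
        rintro _ ⟨e, rfl⟩
        exact hIn e e.2
      have : Fintype (f '' I) := ((Set.toFinite I).image f).fintype
      have : Fintype J := (Set.toFinite J).fintype
      have h := linearIndependent_le_span_aux' (fun e : J => f e) hJ (f '' I) hle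
      have h2 : (f '' I).ncard ≤ I.ncard := Set.ncard_image_le
      rw [Set.ncard_eq_toFinset_card', Set.toFinset_card] at h2
      rw [Set.ncard_eq_toFinset_card' J, Set.toFinset_card] at hlt
      omega)
    (fun _ _ => Set.subset_univ _)).matroid

/-- The signed covectors of the oriented matroid of the arrangement: the vectors of signs of the
linear forms `f_e` at the points of the space. -/
def arrangementCovectors (f : α → Module.Dual ℝ V) : Set (α → SignType) :=
  Set.range fun z : V => fun e => SignType.sign (f e z)

/-- `χ` is one of the two chirotopes of the rank `r` oriented matroid of the arrangement: the
sign of a volume form on the space of linear forms spanned by the `f_e` (with the value `0` at the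
tuples that are not bases). -/
def IsArrangementChirotope (f : α → Module.Dual ℝ V) (r : ℕ) (χ : (Fin r → α) → SignType) :
    Prop :=
  ∃ D : Module.Dual ℝ V [⋀^Fin r]→ₗ[ℝ] ℝ,
    (∃ b : Fin r → α, D (f ∘ b) ≠ 0) ∧ ∀ b : Fin r → α, χ b = SignType.sign (D (f ∘ b))

end Arrangement

/-- The Las Vergnas face lattice `L(P)` of a tope `P`, as a set of flats: the zero sets of those
covectors that arise from `P` by setting some entries to zero. -/
def faceLattice (M : Matroid α) (𝓛 : Set (α → SignType)) (P : α → SignType) : Set (Set α) :=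
  {F | ∃ X ∈ 𝓛, (∀ e ∈ M.E, X e = 0 ∨ X e = P e) ∧ F = {e ∈ M.E | X e = 0}}

/-- The covectors of the contraction by `c`: the covectors that vanish on `c`. -/
def contractCovectors (𝓛 : Set (α → SignType)) (c : Set α) : Set (α → SignType) :=
  {X ∈ 𝓛 | ∀ e ∈ c, X e = 0}

/-- `x ∈ A^r(M)` is the canonical form of the tope `P` of the oriented matroid of rank `r` with
underlying matroid `M`, covectors `𝓛` and chirotope `χ`.  In rank zero it is `χ(∅)`.  In positive
rank, for every atom `c` of the lattice of flats and every `e ∈ c`, one has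
`Res_c x = P(e) Ω_{P/c}` if `c ∈ L(P)`, where the chirotope of the contraction is
`(e_1, …, e_{r-1}) ↦ χ(e_1, …, e_{r-1}, e)`, and `Res_c x = 0` otherwise.
(Only the signs of `P` on the ground set matter, so that `P/c` needs no new notation.) -/
def IsCanonicalForm : (r : ℕ) → (M : Matroid α) → (𝓛 : Set (α → SignType)) →
    (χ : (Fin r → α) → SignType) → (P : α → SignType) → OS M → Prop
  | 0, M, _, χ, _, x => x = (χ Fin.elim0 : ℤ) • osMk M 1
  | r + 1, M, 𝓛, χ, P, x =>
    x ∈ osDegree M (r + 1) ∧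
    ∀ c : Set α, M.IsFlat c → M.eRk c = 1 →
      (c ∈ faceLattice M 𝓛 P → ∀ e ∈ c, ∃ y : OS (M ／ c),
        IsCanonicalForm r (M ／ c) (contractCovectors 𝓛 c)
          (fun b => χ (Fin.snoc (α := fun _ => α) b e)) P y ∧
        osResidue M c x = (P e : ℤ) • y) ∧
      (c ∉ faceLattice M 𝓛 P → osResidue M c x = 0)

open Classical in
/-- The canonical form `Ω_P`. -/
def canonicalForm (r : ℕ) (M : Matroid α) (𝓛 : Set (α → SignType))
    (χ : (Fin r → α) → SignType) (P : α → SignType) : osDegree M r :=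
  if h : ∃ x : osDegree M r, IsCanonicalForm r M 𝓛 χ P x then h.choose else 0

/-! ## Kinematic parameters and amplitudes -/

section Kinematic

variable (α) [Fintype α]

/-- The ring `R_0 = ℤ[a_e] / (∑_e a_e)`. -/
abbrev KinematicRing : Type _ :=
  MvPolynomial α ℤ ⧸ Ideal.span {∑ e : α, (MvPolynomial.X e : MvPolynomial α ℤ)}

instance : IsDomain (KinematicRing α) := by
  rw [Ideal.Quotient.isDomain_iff_prime]
  cases isEmpty_or_nonempty α with
  | inl h => simpa using Ideal.isPrime_bot
  | inr h =>
    classical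
    obtain ⟨i⟩ := h
    have hsum : ∑ e : α, (MvPolynomial.X e : MvPolynomial α ℤ) =
        MvPolynomial.sumSMulX (Finsupp.equivFunOnFinite.symm (fun _ : α => (1 : ℤ))) := by
      simp [MvPolynomial.sumSMulX, Finsupp.linearCombination_apply, Finsupp.sum_fintype]
    have hirr : Irreducible (∑ e : α, (MvPolynomial.X e : MvPolynomial α ℤ)) := by
      rw [hsum]
      refine MvPolynomial.irreducible_sumSMulX _ ⟨i, by simp⟩ ?_
      intro r hr
      exact isUnit_of_dvd_one (by simpa using hr i)
    exact (Ideal.span_singleton_prime hirr.ne_zero).2 hirr.prime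

/-- The field `Q_0 = Frac(R_0)`. -/
abbrev KinematicField : Type _ := FractionRing (KinematicRing α)

variable {α}

/-- The parameter `a_e`, as an element of `Q_0`. -/
def param (e : α) : KinematicField α :=
  algebraMap (KinematicRing α) (KinematicField α) (Ideal.Quotient.mk _ (MvPolynomial.X e))

/-- The amplitude `𝒜(P)` of a tope `P` of an oriented matroid of rank `r`: the deRham intersection
number of the canonical form `Ω_P ∈ A^r(M)` with itself, in the field `Q_0` where
`∑_e a_e = 0`. -/
def matroidAmplitude (r : ℕ) (M : Matroid α) (𝓛 : Set (α → SignType))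
    (χ : (Fin r → α) → SignType) (P : α → SignType) : KinematicField α :=
  deRhamForm M r param (canonicalForm r M 𝓛 χ P) (canonicalForm r M 𝓛 χ P)

end Kinematic

/-! ## The complete graph and the planar `φ³` amplitude -/

/-- The edges `(i, j)`, `i < j`, of the complete graph on `n` vertices. -/
abbrev Edge (n : ℕ) : Type := {p : Fin n × Fin n // p.1 < p.2}

/-- The linear forms `z_j - z_i`, `i < j`, of the braid arrangement. -/
def braidForm (n : ℕ) (p : Edge n) : Module.Dual ℝ (Fin n → ℝ) :=
  (LinearMap.proj p.1.2 : (Fin n → ℝ) →ₗ[ℝ] ℝ) - LinearMap.proj p.1.1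

/-- The graphic matroid `M(K_n)`, as the matroid of the braid arrangement. -/
def completeGraphMatroid (n : ℕ) : Matroid (Edge n) := arrangementMatroid (braidForm n)

/-- The tope `P_σ` of a permutation `σ`: the sign at `(i, j)` is `+` if
`σ⁻¹(i) < σ⁻¹(j)` and `-` otherwise. -/
def permTope {n : ℕ} (σ : Equiv.Perm (Fin n)) (p : Edge n) : SignType :=
  if σ.symm p.1.1 < σ.symm p.1.2 then 1 else -1

/-- The `(n+1)`-point planar `φ³` amplitude `𝒜(P_id)` (also called biadjoint scalar amplitude),
for the chirotope `χ` of the oriented matroid of the braid arrangement, which has rank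
`n - 1`. -/
def phi3Amplitude (n : ℕ) (χ : (Fin (n - 1) → Edge n) → SignType) : KinematicField (Edge n) :=
  matroidAmplitude (n - 1) (completeGraphMatroid n) (arrangementCovectors (braidForm n)) χ
    (permTope (1 : Equiv.Perm (Fin n)))

/-! ## Cubic planar trees and temporal Feynman diagrams -/

/-- A branch of a cubic planar tree with some leaves labelled by `Fin n`: either a single leaf, or
a cubic vertex where two branches (a left and a right one) join; its open end points towards the
leaf `n+1`. -/
inductive Branch (n : ℕ) : Type
  | leaf (i : Fin n) : Branch n
  | join (l r : Branch n) : Branch n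

namespace Branch

variable {n : ℕ}

/-- The labels of the leaves, in their planar order. -/
def leaves : Branch n → List (Fin n)
  | leaf i => [i]
  | join l r => leaves l ++ leaves r

open Classical in
/-- All branches contained in a given one (including itself). -/
def subbranches : Branch n → Finset (Branch n)
  | leaf i => {leaf i}
  | join l r => insert (join l r) (subbranches l ∪ subbranches r)

/-- The branch consists of a single leaf. -/
def IsLeaf (b : Branch n) : Prop := ∃ i, b = leaf i

end Branch

/-- A cubic planar tree with leaves `1, …, n+1` in cyclic order.  The leaf `n+1` is attached to
the open end of a branch whose leaves are, in planar order, the first `n` labels (numbered here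
from `0` to `n - 1`). -/
abbrev CubicPlanarTree (n : ℕ) : Type := {T : Branch n // T.leaves = List.finRange n}

theorem finite_leaves_eq {n : ℕ} (k : ℕ) :
    ∀ w : List (Fin n), w.length = k → {T : Branch n | T.leaves = w}.Finite := by
  induction k using Nat.strong_induction_on with
  | _ k ih =>
    intro w hw
    have hne : ∀ T : Branch n, 0 < T.leaves.length := by
      intro T
      induction T with
      | leaf i => simp [Branch.leaves]
      | join l r hl hr => simp only [Branch.leaves, List.length_append]; omega
    refine ((Set.finite_range (Branch.leaf (n := n))).union
      (Set.Finite.biUnion (Set.finite_Ioo 0 k) (t := fun i =>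
        Set.image2 Branch.join {T | T.leaves = w.take i} {T | T.leaves = w.drop i}) ?_)).subset ?_
    · intro i hi
      refine Set.Finite.image2 _ (ih i hi.2 _ ?_) (ih (k - i) ?_ _ ?_)
      · rw [List.length_take, hw]; exact min_eq_left hi.2.le
      · have := hi.1; have := hi.2; omega
      · rw [List.length_drop, hw]
    · rintro (i | ⟨l, r⟩) hT
      · exact Or.inl ⟨i, rfl⟩
      · right
        have h1 := hne l
        have h2 := hne r
        have hT' : l.leaves ++ r.leaves = w := hT
        have hlen : l.leaves.length + r.leaves.length = k := by
          rw [← hw, ← hT', List.length_append]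
        refine Set.mem_biUnion (x := l.leaves.length) ⟨h1, by omega⟩ ⟨l, ?_, r, ?_, rfl⟩
        · simp [← hT']
        · simp [← hT']

instance (n : ℕ) : Finite (CubicPlanarTree n) :=
  (finite_leaves_eq n (List.finRange n) (by simp)).to_subtype

namespace CubicPlanarTree

variable {n : ℕ}

open Classical in
/-- The internal edges `I(T)`, that is, the edges that are not incident to any leaf.  An edge `e`
is recorded by the branch that remains of the component of `T \ e` not containing the leaf
`n+1`; the edge is incident to a leaf when this branch is a single leaf, or is everything but the
leaf `n+1`. -/
def internalEdges (T : CubicPlanarTree n) : Finset (Branch n) :=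
  {e ∈ T.1.subbranches | ¬ e.IsLeaf ∧ e ≠ T.1}

variable {T : CubicPlanarTree n}

/-- `e ⪯ e'` if the path from `e` to the leaf `n+1` passes through `e'`. -/
def edgeLE (e e' : T.internalEdges) : Prop := e.1 ∈ e'.1.subbranches

/-- The set `S_e` of labels of the leaves in the component of `T \ e` not containing the leaf
`n+1`. -/
def leafSet (e : T.internalEdges) : Finset (Fin n) := e.1.leaves.toFinset

/-- `F(S_e) = {(i, j) | i < j and i, j ∈ S_e}`. -/
def edgeFlat (e : T.internalEdges) : Finset (Edge n) :=
  {p | p.1.1 ∈ leafSet e ∧ p.1.2 ∈ leafSet e}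

end CubicPlanarTree

/-- A temporal Feynman diagram: a cubic planar tree with a total order on its internal edges such
that `e ⪯ e'` implies `e ≤ e'`. -/
structure TemporalFeynmanDiagram (n : ℕ) where
  tree : CubicPlanarTree n
  le : tree.internalEdges → tree.internalEdges → Prop
  isLinearOrder : IsLinearOrder tree.internalEdges le
  le_of_edgeLE : ∀ e e', CubicPlanarTree.edgeLE e e' → le e e'

instance (n : ℕ) : Finite (TemporalFeynmanDiagram n) :=
  Finite.of_injective
    (fun D : TemporalFeynmanDiagram n =>
      (⟨D.tree, D.le⟩ :
        Σ T : CubicPlanarTree n, T.internalEdges → T.internalEdges → Prop))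
    (by
      rintro ⟨T, r, h1, h2⟩ ⟨T', r', h1', h2'⟩ h
      simp only [Sigma.mk.injEq] at h
      obtain ⟨rfl, h⟩ := h
      obtain rfl := eq_of_heq h
      rfl)

instance (n : ℕ) : Fintype (TemporalFeynmanDiagram n) := Fintype.ofFinite _

namespace TemporalFeynmanDiagram

variable {n : ℕ} (D : TemporalFeynmanDiagram n)

open Classical in
/-- `D(e)`: the `⪯`-maximal elements of `I_{≤ e} = {e' | e' ≤ e}`. -/
def maximalEdges (e : D.tree.internalEdges) : Finset D.tree.internalEdges :=
  {e' | D.le e' e ∧ ∀ e'', D.le e'' e → CubicPlanarTree.edgeLE e' e'' → e'' = e'}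

open Classical in
/-- `F_≤(e) = ⋃_{e' ∈ D(e)} F(S_{e'})`. -/
def temporalFlat (e : D.tree.internalEdges) : Finset (Edge n) :=
  (D.maximalEdges e).biUnion CubicPlanarTree.edgeFlat

/-- The temporal propagator `Y_e = ∑_{(i,j) ∈ F_≤(e)} a_{(i,j)}`. -/
def temporalPropagator (e : D.tree.internalEdges) : KinematicField (Edge n) :=
  ∑ p ∈ D.temporalFlat e, param p

end TemporalFeynmanDiagram

end MatroidAmplitude

end

namespace MatroidAmplitude

/-! ### Canonical forms and residues of simplicial topes. -/

section Generic

variable {α : Type*}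

/-! The chamber z_1 < ... < z_n is simplicial. Its facets are the m = n - 1 hyperplanes z_g =
z_{g+1}, one for each step between consecutive vertices, and its faces correspond to the sets J of
steps: the flat `stepFlat J` consists of the pairs (i, j) with all steps between i and j in J. The
canonical form of a simplicial tope is a single monomial, the wedge of the facet elements with the
chirotope as coefficient (`IsSimplicialTope.isCanonicalForm_chiMonomial`), because a residue along a
facet strikes out one factor and leaves the same kind of monomial for the contraction. Hence
iterated residues are 1 or -1 along flags of faces and 0 along all other flags; they enter the
amplitude squared, so signs disappear (`IsSimplicialTope.flagResidue_sq`). Maximal flags in a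
Boolean lattice are orderings σ of the steps, and the amplitude is the sum over σ of ∏_{0 < i < m} 1
/ a_{F_i}, where F_i is the flat of the first i steps in σ (`phi3Amplitude_eq_sum_perm`).

A temporal Feynman diagram carries the same data. Every vertex of a planar binary tree sits over
exactly one gap between consecutive leaves, and the total order of the internal edges, with the root
vertex put last, lists all the gaps. Conversely an ordering of the gaps determines the tree: the
last gap belongs to the root and splits the leaves in two, and one recurses. This is the classical
bijection between permutations and increasing binary trees, recorded by
`TemporalFeynmanDiagram.Compatible`.

Under this bijection the temporal flat of the i-th internal edge is F_i. Two leaves lie in a common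
branch among those of D(e) exactly when the vertex where they meet is not later than e, that is,
when no gap between them is later than e (`TemporalFeynmanDiagram.Compatible.mem_temporalFlat`). So
the two sums agree term by term; neither a_E = 0 nor the nonvanishing of denominators plays a role.
-/

theorem mem_faceLattice_contract {M : Matroid α} {𝓛 : Set (α → SignType)} {P : α → SignType}
    {c F : Set α} (hc : c ⊆ M.E) :
    F ∈ faceLattice (M ／ c) (contractCovectors 𝓛 c) P ↔
      Disjoint F c ∧ F ∪ c ∈ faceLattice M 𝓛 P := by
  constructor
  · rintro ⟨X, ⟨hX, hXc⟩, hXP, rfl⟩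
    refine ⟨Set.disjoint_left.2 fun e he => he.1.2, X, hX, fun e he => ?_, ?_⟩
    · by_cases hec : e ∈ c
      · exact Or.inl (hXc e hec)
      · exact hXP e ⟨he, hec⟩
    · ext e
      simp only [Matroid.contract_ground, Set.mem_union, Set.mem_ofPred_eq, Set.mem_sdiff]
      refine ⟨?_, fun ⟨h1, h2⟩ => ?_⟩
      · rintro (h | h)
        · exact ⟨h.1.1, h.2⟩
        · exact ⟨hc h, hXc e h⟩
      · by_cases hec : e ∈ c
        · exact Or.inr hec
        · exact Or.inl ⟨⟨h1, hec⟩, h2⟩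
  · rintro ⟨hd, X, hX, hXP, hF⟩
    have key : ∀ e, e ∈ F ∪ c ↔ e ∈ M.E ∧ X e = 0 := fun e => by rw [hF]; rfl
    refine ⟨X, ⟨hX, fun e he => ((key e).1 (Or.inr he)).2⟩, fun e he => hXP e he.1, ?_⟩
    ext e
    refine ⟨fun he => ?_, fun ⟨⟨h1, h2⟩, h3⟩ => ?_⟩
    · obtain ⟨h1, h2⟩ := (key e).1 (Or.inl he)
      exact ⟨⟨h1, Set.disjoint_left.1 hd he⟩, h2⟩
    · exact ((key e).2 ⟨h1, h3⟩).resolve_right h2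

theorem loopless_contract {M : Matroid α} {c : Set α} (hc : M.IsFlat c) : (M ／ c).Loopless :=
  ⟨by rw [Matroid.contract_loops_eq, hc.closure, sdiff_self]; rfl⟩

/-- The flag induced on the contraction by the first nontrivial flat of a flag. -/
theorem IsSaturatedFlag.contract {M : Matroid α} {k : ℕ} {F : Fin (k + 1 + 1) → Set α}
    (hF : IsSaturatedFlag M (k + 1) F) :
    IsSaturatedFlag (M ／ F 1) k (fun i => F i.succ \ F 1) := by
  have h1 : ∀ i : Fin (k + 1), F 1 ⊆ F i.succ := fun i =>
    hF.monotone (by rw [← Fin.succ_zero_eq_one]; exact Fin.succ_le_succ_iff.2 (Fin.zero_le i))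
  refine ⟨fun i => ?_, fun i => ?_, fun i j hij => ?_⟩
  · rw [Matroid.isFlat_iff_closure_eq, Matroid.contract_closure_eq, Set.sdiff_union_self,
      Set.union_eq_self_of_subset_right (h1 i), (hF.isFlat _).closure]
  · obtain ⟨I, hI⟩ := M.exists_isBasis (F 1) (hF.isFlat 1).subset_ground
    obtain ⟨J, hJ, hIJ⟩ := hI.indep.subset_isBasis_of_subset (hI.subset.trans (h1 i))
      (hF.isFlat _).subset_ground
    have hJI : J ∩ F 1 = I := (hI.eq_of_subset_indep (hJ.indep.inter_right _)
      (Set.subset_inter hIJ hI.subset) Set.inter_subset_right).symm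
    have hd : J \ F 1 = J \ I := by rw [← hJI, Set.sdiff_self_inter]
    have hb : (M ／ F 1).IsBasis (J \ F 1) (F i.succ \ F 1) :=
      hJ.contract_isBasis hI (by rw [hd, Set.sdiff_union_of_subset hIJ]; exact hJ.indep)
    rw [hb.eRk_eq_encard, hd]
    have hcard := Set.encard_sdiff_add_encard_of_subset hIJ
    rw [hJ.encard_eq_eRk, hI.encard_eq_eRk, hF.rank, hF.rank] at hcard
    simp only [Fin.val_one, Fin.val_succ, Nat.cast_one, Nat.cast_add] at hcard
    exact ENat.add_left_injective_of_ne_top (by simp) hcard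
  · exact Set.sdiff_subset_sdiff_left (hF.monotone (Fin.succ_le_succ_iff.2 hij))

/-- The monomial `e_{b_0} ∧ ⋯ ∧ e_{b_{k-1}}`, with coefficient `χ(b)`. -/
noncomputable def chiMonomial {k : ℕ} (χ : (Fin k → α) → SignType) (b : Fin k → α) : Ext α :=
  (χ b : ℤ) • ExteriorAlgebra.ιMulti ℤ k (fun i => Finsupp.single (b i) (1 : ℤ))

theorem chi_perm {k : ℕ} {χ : (Fin k → α) → SignType}
    (h : ∀ v i j, i ≠ j → χ (v ∘ Equiv.swap i j) = -χ v) (v : Fin k → α)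
    (σ : Equiv.Perm (Fin k)) : (χ (v ∘ σ) : ℤ) = (Equiv.Perm.sign σ : ℤ) * (χ v : ℤ) := by
  induction σ using Equiv.Perm.swap_induction_on generalizing v with
  | one => simp
  | swap_mul f x y hxy ih =>
    have : v ∘ ⇑(Equiv.swap x y * f) = (v ∘ Equiv.swap x y) ∘ f := rfl
    rw [this, ih, h v x y hxy, Equiv.Perm.sign_mul, Equiv.Perm.sign_swap hxy]
    cases χ v <;> simp

/-- The coefficient and the wedge product change by the same sign, and the two signs cancel. So any
factor can be moved to the last place, where the residue removes it. -/
theorem chiMonomial_perm {k : ℕ} {χ : (Fin k → α) → SignType}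
    (h : ∀ v i j, i ≠ j → χ (v ∘ Equiv.swap i j) = -χ v) (b : Fin k → α)
    (σ : Equiv.Perm (Fin k)) : chiMonomial χ (b ∘ σ) = chiMonomial χ b := by
  have h2 := (ExteriorAlgebra.ιMulti ℤ k (M := α →₀ ℤ)).map_perm
    (fun i => Finsupp.single (b i) (1 : ℤ)) σ
  unfold chiMonomial
  rw [chi_perm h]
  change _ • ExteriorAlgebra.ιMulti ℤ k ((fun i => Finsupp.single (b i) (1 : ℤ)) ∘ σ) = _
  rw [h2, Units.smul_def, smul_smul, mul_right_comm, ← Units.val_mul, Int.units_mul_self]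
  simp

theorem ιMulti_single_eq_prod {k : ℕ} (b : Fin k → α) :
    ExteriorAlgebra.ιMulti ℤ k (fun i => Finsupp.single (b i) (1 : ℤ)) =
      ((List.ofFn b).map gen).prod := by
  rw [ExteriorAlgebra.ιMulti_apply, List.map_ofFn]; rfl

theorem snoc_succAbove_eq_comp {k : ℕ} (b : Fin (k + 1) → α) (i : Fin (k + 1)) :
    ∃ τ : Equiv.Perm (Fin (k + 1)),
      (Fin.snoc (α := fun _ => α) (b ∘ i.succAbove) (b i) : Fin (k + 1) → α) = b ∘ τ := by
  -- Rotation turns appending at the end into prepending; the inverse of `cycleRange` then carries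
  -- the first place to i and the others past it in order.
  refine ⟨(finRotate (k + 1)).trans i.cycleRange.symm, ?_⟩
  rw [Fin.snoc_eq_cons_rotate]
  funext j
  simp only [Function.comp_apply, Equiv.trans_apply]
  generalize finRotate (k + 1) j = l
  refine Fin.cases ?_ (fun l => ?_) l
  · simp
  · simp [Fin.cycleRange_symm_succ]

theorem extResidue_prod_concat {c : Set α} (l : List α) (hl : ∀ e ∈ l, e ∉ c) {e : α}
    (he : e ∈ c) : extResidue c (((l ++ [e]).map gen).prod) = (l.map gen).prod := by
  change killGens c (contractRight _ (indicatorFunctional c)) = _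
  rw [List.map_append, List.prod_append, List.map_singleton, List.prod_singleton,
    contract_mul_gen, contract_prod_of_disjoint c l hl, indicatorFunctional_single_of_mem he]
  simp [killGens_prod_of_disjoint c l hl]

theorem extResidue_prod_of_disjoint {c : Set α} (l : List α) (hl : ∀ e ∈ l, e ∉ c) :
    extResidue c ((l.map gen).prod) = 0 := by
  change killGens c (contractRight _ (indicatorFunctional c)) = _
  rw [contract_prod_of_disjoint c l hl, map_zero]

theorem osResidue_osMk {M : Matroid α} [M.Loopless] {c : Set α} (hc : c ⊆ M.E) (z : Ext α) :
    osResidue M c (osMk M z) = osMk (M ／ c) (extResidue c z) := by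
  rw [osResidue, dif_pos ⟨inferInstance, hc⟩]; rfl

theorem osMk_chiMonomial_mem (M : Matroid α) {k : ℕ} (χ : (Fin k → α) → SignType)
    (b : Fin k → α) : osMk M (chiMonomial χ b) ∈ osDegree M k := by
  refine Submodule.mem_map_of_mem (Submodule.smul_mem _ _ ?_)
  exact ExteriorAlgebra.ιMulti_range ℤ k ⟨_, rfl⟩

/-- The all-positive tope of an oriented matroid with chirotope `χ` is simplicial, with its
facets cut out by the elements of the independent tuple `b`. -/
structure IsSimplicialTope {k : ℕ} (M : Matroid α) (𝓛 : Set (α → SignType))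
    (χ : (Fin k → α) → SignType) (b : Fin k → α) : Prop where
  loopless : M.Loopless
  injective : Function.Injective b
  indep : M.Indep (Set.range b)
  mem_faceLattice : ∀ F, F ∈ faceLattice M 𝓛 (fun _ => 1) ↔
    ∃ I : Set (Fin k), F = M.closure (b '' I)
  chi_swap : ∀ v i j, i ≠ j → χ (v ∘ Equiv.swap i j) = -χ v
  -- This encodes that e is a positive multiple of b_i modulo the b_l with l in I, which already
  -- occur in v away from position j. Allowing a nonempty I makes the condition stable under
  -- contraction, since contracted elements can be added to I.
  chi_exchange : ∀ (v : Fin k → α) (j i : Fin k) (I : Set (Fin k)) (e : α),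
    (∀ l ∈ I, ∃ j' ≠ j, v j' = b l) → e ∈ M.closure (b '' insert i I) →
    e ∉ M.closure (b '' I) → χ (Function.update v j e) = χ (Function.update v j (b i))
  chi_ne_zero : χ b ≠ 0

namespace IsSimplicialTope

variable {k : ℕ} {M : Matroid α} {𝓛 : Set (α → SignType)}

theorem mem_closure_iff {χ : (Fin k → α) → SignType} {b : Fin k → α}
    (h : IsSimplicialTope M 𝓛 χ b) {I : Set (Fin k)} {i : Fin k} :
    b i ∈ M.closure (b '' I) ↔ i ∈ I := by
  refine ⟨fun hi => ?_, fun hi => M.mem_closure_of_mem' (Set.mem_image_of_mem b hi)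
    (h.indep.subset_ground ⟨i, rfl⟩)⟩
  by_contra hiI
  refine h.indep.notMem_closure_sdiff_of_mem ⟨i, rfl⟩
    (M.closure_subset_closure (Y := Set.range b \ {b i}) ?_ hi)
  rintro _ ⟨j, hj, rfl⟩
  exact ⟨⟨j, rfl⟩, fun h' => hiI (h.injective h' ▸ hj)⟩

theorem exists_eq_closure_singleton {χ : (Fin k → α) → SignType} {b : Fin k → α}
    (h : IsSimplicialTope M 𝓛 χ b) {c : Set α} (hc : c ∈ faceLattice M 𝓛 (fun _ => 1))
    (hrk : M.eRk c = 1) : ∃ i, c = M.closure {b i} := by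
  obtain ⟨I, rfl⟩ := (h.mem_faceLattice c).1 hc
  rw [M.eRk_closure_eq, (h.indep.subset (Set.image_subset_range b I)).eRk_eq_encard,
    h.injective.encard_image, Set.encard_eq_one] at hrk
  obtain ⟨i, rfl⟩ := hrk
  exact ⟨i, by rw [Set.image_singleton]⟩

theorem closure_singleton_mem {χ : (Fin k → α) → SignType} {b : Fin k → α}
    (h : IsSimplicialTope M 𝓛 χ b) (i : Fin k) :
    M.closure {b i} ∈ faceLattice M 𝓛 (fun _ => 1) :=
  (h.mem_faceLattice _).2 ⟨{i}, by rw [Set.image_singleton]⟩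

/-- The contracted chirotope depends on a choice of e in the atom, and atoms of contractions may
have several elements; this reduces every choice to b_i. It is `chi_exchange` with I empty,
looplessness keeping e out of the closure of ∅. -/
theorem chi_exchange_last {χ : (Fin (k + 1) → α) → SignType} {b : Fin (k + 1) → α}
    (h : IsSimplicialTope M 𝓛 χ b) {i : Fin (k + 1)} {e : α} (he : e ∈ M.closure {b i})
    (w : Fin k → α) : χ (Fin.snoc (α := fun _ => α) w e) =
      χ (Fin.snoc (α := fun _ => α) w (b i)) := by
  have := h.loopless
  have := h.chi_exchange (Fin.snoc (α := fun _ => α) w e) (Fin.last k) i ∅ e (by simp)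
    (by simpa using he) (by simp [Matroid.closure_empty])
  rwa [Fin.update_snoc_last, Fin.update_snoc_last] at this

/-- This drives both inductions on the rank, for the shape of the canonical form and for its
residues along flags. Faces of the contraction are faces containing the contracted facet, so the
Boolean description passes on with i removed. -/
theorem contract {χ : (Fin (k + 1) → α) → SignType} {b : Fin (k + 1) → α}
    (h : IsSimplicialTope M 𝓛 χ b) (i : Fin (k + 1)) {e : α} (he : e ∈ M.closure {b i}) :
    IsSimplicialTope (M ／ M.closure {b i}) (contractCovectors 𝓛 (M.closure {b i}))
      (fun v => χ (Fin.snoc (α := fun _ => α) v e)) (b ∘ i.succAbove) := by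
  have hbi : M.IsBasis {b i} (M.closure {b i}) :=
    (h.indep.subset (Set.singleton_subset_iff.2 ⟨i, rfl⟩)).isBasis_closure
  have hflat : M.IsFlat (M.closure {b i}) := M.isFlat_closure _
  have hcl : ∀ I : Set (Fin k), (M ／ M.closure {b i}).closure ((b ∘ i.succAbove) '' I) =
      M.closure (b '' insert i (i.succAbove '' I)) \ M.closure {b i} := by
    intro I
    rw [Matroid.contract_closure_eq, Matroid.closure_union_closure_right_eq, Set.image_comp,
      Set.image_insert_eq, Set.union_singleton]
  have hsub : ∀ I : Set (Fin k),
      M.closure {b i} ⊆ M.closure (b '' insert i (i.succAbove '' I)) := fun I =>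
    M.closure_subset_closure (by rw [Set.image_insert_eq]; simp)
  refine ⟨loopless_contract hflat, h.injective.comp Fin.succAbove_right_injective, ?_, ?_, ?_, ?_,
    ?_⟩
  · rw [hbi.contract_indep_iff]
    refine ⟨h.indep.subset ?_, Set.disjoint_right.2 ?_⟩
    · rintro _ (⟨j, rfl⟩ | rfl)
      · exact ⟨_, rfl⟩
      · exact ⟨i, rfl⟩
    · rintro _ ⟨j, rfl⟩ hj
      have : b (i.succAbove j) ∈ M.closure (b '' {i}) := by rwa [Set.image_singleton]
      exact Fin.succAbove_ne i j ((h.mem_closure_iff (I := {i})).1 this)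
  · intro F
    rw [mem_faceLattice_contract hflat.subset_ground, h.mem_faceLattice]
    constructor
    · rintro ⟨hd, I, hI⟩
      refine ⟨i.succAbove ⁻¹' I, ?_⟩
      -- The face contains b_i, so independence puts i into I, and I is recovered from its trace on
      -- the remaining indices.
      have hiI : i ∈ I := h.mem_closure_iff.1 (hI ▸ Or.inr (M.mem_closure_of_mem' rfl
        (h.indep.subset_ground ⟨i, rfl⟩)))
      have hII : insert i (i.succAbove '' (i.succAbove ⁻¹' I)) = I := by
        ext j
        rcases Fin.eq_self_or_eq_succAbove i j with rfl | ⟨l, rfl⟩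
        · simp [hiI]
        · simp
      rw [hcl, hII, ← hI, Set.union_sdiff_right, hd.sdiff_eq_left]
    · rintro ⟨I, rfl⟩
      rw [hcl]
      exact ⟨disjoint_sdiff_self_left, _, Set.sdiff_union_of_subset (hsub I)⟩
  · intro v j l hjl
    rw [← h.chi_swap _ j.castSucc l.castSucc (by simpa using hjl)]
    congr 1
    funext x
    refine Fin.lastCases ?_ (fun x => ?_) x
    · rw [Function.comp_apply, Equiv.swap_apply_of_ne_of_ne (Fin.castSucc_ne_last j).symm
        (Fin.castSucc_ne_last l).symm]
      simp
    · simp only [Fin.snoc_castSucc, Function.comp_apply]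
      rw [← (Fin.castSucc_injective k).map_swap, Fin.snoc_castSucc]
  · intro v j i' I e' hv he' he''
    rw [hcl] at he' he''
    have h1 : ∀ x, (Fin.snoc (α := fun _ => α) (Function.update v j x) (b i) : Fin (k + 1) → α) =
        Function.update (Fin.snoc (α := fun _ => α) v (b i)) j.castSucc x := fun x =>
      Fin.snoc_update (α := fun _ => α) _ _ _ _
    change χ _ = χ _
    rw [h.chi_exchange_last he, h.chi_exchange_last he, h1, h1]
    -- The contracted element b_i joins the exchange set; it occurs in the extended tuple at the
    -- last position.
    refine h.chi_exchange _ _ (i.succAbove i') (insert i (i.succAbove '' I)) e' ?_ ?_ ?_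
    · rintro l (rfl | ⟨l, hl, rfl⟩)
      · exact ⟨Fin.last k, (Fin.castSucc_ne_last j).symm, by simp⟩
      · obtain ⟨j', hj', hj''⟩ := hv l hl
        exact ⟨j'.castSucc, by simpa using hj', by simpa using hj''⟩
    · rw [Set.insert_comm, ← Set.image_insert_eq]; exact he'.1
    · exact fun h' => he'' ⟨h', he'.2⟩
  · rw [h.chi_exchange_last he]
    obtain ⟨τ, hτ⟩ := snoc_succAbove_eq_comp b i
    rw [hτ]
    intro h0
    have := chi_perm h.chi_swap b τ
    rw [h0] at this
    have h2 : (χ b : ℤ) = 0 := by simpa using this.symm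
    refine h.chi_ne_zero ?_
    revert h2
    cases χ b <;> simp

/-- Once b_i has been moved to the end, independence shows that it is the only factor in its
closure. The residue deletes it, and the coefficient is by definition a value of the contracted
chirotope. -/
theorem osResidue_chiMonomial {χ : (Fin (k + 1) → α) → SignType} {b : Fin (k + 1) → α}
    (h : IsSimplicialTope M 𝓛 χ b) (i : Fin (k + 1)) {e : α} (he : e ∈ M.closure {b i}) :
    osResidue M (M.closure {b i}) (osMk M (chiMonomial χ b)) = osMk (M ／ M.closure {b i})
      (chiMonomial (fun v => χ (Fin.snoc (α := fun _ => α) v e)) (b ∘ i.succAbove)) := by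
  have := h.loopless
  obtain ⟨τ, hτ⟩ := snoc_succAbove_eq_comp b i
  rw [osResidue_osMk (M.isFlat_closure _).subset_ground, ← chiMonomial_perm h.chi_swap b τ, ← hτ]
  congr 1
  simp only [chiMonomial, h.chi_exchange_last he]
  rw [map_zsmul, ιMulti_single_eq_prod, ιMulti_single_eq_prod, List.ofFn_succ']
  simp only [Fin.snoc_castSucc, Fin.snoc_last, List.concat_eq_append]
  rw [extResidue_prod_concat]
  · intro x hx hxc
    obtain ⟨j, rfl⟩ := (List.mem_ofFn' _ _).1 hx
    have : b (i.succAbove j) ∈ M.closure (b '' {i}) := by rwa [Set.image_singleton]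
    exact Fin.succAbove_ne i j ((h.mem_closure_iff (I := {i})).1 this)
  · exact M.mem_closure_of_mem' rfl (h.indep.subset_ground ⟨i, rfl⟩)

/-- If some factor b_i lay in the rank-one flat c, then c would be the closure of b_i and therefore
a face. So no factor lies in c. -/
theorem osResidue_chiMonomial_eq_zero {χ : (Fin k → α) → SignType} {b : Fin k → α}
    (h : IsSimplicialTope M 𝓛 χ b) {c : Set α} (hc : M.IsFlat c) (hrk : M.eRk c = 1)
    (hcF : c ∉ faceLattice M 𝓛 (fun _ => 1)) :
    osResidue M c (osMk M (chiMonomial χ b)) = 0 := by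
  have := h.loopless
  rw [osResidue_osMk hc.subset_ground, chiMonomial, map_zsmul, ιMulti_single_eq_prod,
    extResidue_prod_of_disjoint, smul_zero, map_zero]
  intro x hx hxc
  obtain ⟨i, rfl⟩ := (List.mem_ofFn' _ _).1 hx
  refine hcF ?_
  have hle : M.eRk c ≤ M.eRk {b i} := by
    rw [hrk, M.eRk_singleton_eq (h.indep.subset_ground ⟨i, rfl⟩)]
  have := (Matroid.isRkFinite_singleton (M := M) (e := b i)).closure_eq_closure_of_subset_of_eRk_ge_eRk
    (Set.singleton_subset_iff.2 hxc) hle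
  rw [← hc.closure, ← this]
  exact h.closure_singleton_mem i

/-- The canonical form of a simplicial tope is a monomial. -/
theorem isCanonicalForm_chiMonomial {k : ℕ} {M : Matroid α} {𝓛 : Set (α → SignType)}
    {χ : (Fin k → α) → SignType} {b : Fin k → α} (h : IsSimplicialTope M 𝓛 χ b) :
    IsCanonicalForm k M 𝓛 χ (fun _ => 1) (osMk M (chiMonomial χ b)) := by
  induction k generalizing M 𝓛 with
  | zero =>
    rw [IsCanonicalForm, chiMonomial, map_zsmul, Subsingleton.elim b Fin.elim0]
    simp [ExteriorAlgebra.ιMulti_apply]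
  | succ k ih =>
    refine ⟨osMk_chiMonomial_mem M χ b, fun c hc hrk => ⟨fun hcF e he => ?_,
      h.osResidue_chiMonomial_eq_zero hc hrk⟩⟩
    obtain ⟨i, rfl⟩ := h.exists_eq_closure_singleton hcF hrk
    refine ⟨_, ih (h.contract i he), ?_⟩
    rw [h.osResidue_chiMonomial i he]
    simp

theorem mem_faceLattice_zero {χ : (Fin k → α) → SignType} {b : Fin k → α}
    (h : IsSimplicialTope M 𝓛 χ b) {F : Fin (k + 1) → Set α} (hF : IsSaturatedFlag M k F) :
    F 0 ∈ faceLattice M 𝓛 (fun _ => 1) := by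
  have := h.loopless
  have h0 := hF.rank 0
  rw [Fin.val_zero, Nat.cast_zero, Matroid.eRk_eq_zero_iff (hF.isFlat 0).subset_ground,
    M.loops_eq_empty, Set.subset_empty_iff] at h0
  rw [h0]
  exact (h.mem_faceLattice _).2 ⟨∅, by simp [Matroid.closure_empty]⟩

open Classical in
/-- The square of the residue of the canonical form of a simplicial tope along a flag is `1` if
the flag consists of faces of the tope, and `0` otherwise. -/
theorem flagResidue_sq {k : ℕ} {M : Matroid α} {𝓛 : Set (α → SignType)}
    {χ : (Fin k → α) → SignType} {b : Fin k → α} (h : IsSimplicialTope M 𝓛 χ b) {x : OS M}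
    (hx : IsCanonicalForm k M 𝓛 χ (fun _ => 1) x) {F : Fin (k + 1) → Set α}
    (hF : IsSaturatedFlag M k F) :
    flagResidue k M F x ^ 2 = if ∀ i, F i ∈ faceLattice M 𝓛 (fun _ => 1) then 1 else 0 := by
  induction k generalizing M 𝓛 with
  | zero =>
    have := h.loopless
    have hF0 := h.mem_faceLattice_zero hF
    rw [if_pos (fun i => by rwa [Fin.fin_one_eq_zero i])]
    rw [IsCanonicalForm] at hx
    have h1 : osAugmentation M (osMk M 1) = 1 := by
      rw [osAugmentation, dif_pos this]
      exact map_one (ExteriorAlgebra.algebraMapInv : Ext α →ₐ[ℤ] ℤ)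
    rw [flagResidue, hx, map_zsmul, h1, Subsingleton.elim Fin.elim0 b]
    have := h.chi_ne_zero
    revert this
    cases χ b <;> simp
  | succ k ih =>
    have := h.loopless
    have hF0 := h.mem_faceLattice_zero hF
    have hrk : M.eRk (F 1) = 1 := by simpa using hF.rank 1
    obtain ⟨hx1, hx2⟩ := hx.2 (F 1) (hF.isFlat 1) hrk
    rw [flagResidue, LinearMap.comp_apply]
    by_cases hF1 : F 1 ∈ faceLattice M 𝓛 (fun _ => 1)
    · have hflag := hF.contract
      have hsub : ∀ i : Fin (k + 1), F 1 ⊆ F i.succ := fun i =>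
        hF.monotone (by rw [← Fin.succ_zero_eq_one]; exact Fin.succ_le_succ_iff.2 (Fin.zero_le i))
      have hiff : (∀ i, F i ∈ faceLattice M 𝓛 (fun _ => 1)) ↔
          ∀ i : Fin (k + 1), F i.succ \ F 1 ∈
            faceLattice (M ／ F 1) (contractCovectors 𝓛 (F 1)) (fun _ => 1) := by
        rw [Fin.forall_fin_succ, and_iff_right hF0]
        refine forall_congr' fun i => ?_
        rw [mem_faceLattice_contract (hF.isFlat 1).subset_ground,
          and_iff_right disjoint_sdiff_self_left, Set.sdiff_union_of_subset (hsub i)]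
      rw [if_congr hiff rfl rfl]
      obtain ⟨i, hi⟩ := h.exists_eq_closure_singleton hF1 hrk
      generalize F 1 = c at *
      subst hi
      have he : b i ∈ M.closure {b i} :=
        M.mem_closure_of_mem' rfl (h.indep.subset_ground ⟨i, rfl⟩)
      obtain ⟨y, hy, hxy⟩ := hx1 hF1 (b i) he
      rw [hxy]
      simp only [SignType.coe_one, one_smul]
      exact ih (h.contract i he) hy hflag
    · rw [hx2 hF1, map_zero, if_neg (fun h' => hF1 (h' 1))]
      rfl

end IsSimplicialTope

end Generic

/-! ### The fundamental chamber of the braid arrangement and its maximal flags. -/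

section Braid

variable {m : ℕ}

/-- The edge that joins two consecutive vertices. -/
def simpleEdge (g : Fin m) : Edge (m + 1) := ⟨(g.castSucc, g.succ), Fin.castSucc_lt_succ⟩

/-- The steps of the path of simple edges between the endpoints of `e`. -/
def edgeSteps (e : Edge (m + 1)) : Finset (Fin m) :=
  {g | e.1.1 ≤ g.castSucc ∧ g.succ ≤ e.1.2}

/-- The edges whose endpoints are joined by a path of simple edges in `J`. -/
def stepFlat (J : Set (Fin m)) : Set (Edge (m + 1)) := {e | ∀ g ∈ edgeSteps e, g ∈ J}

theorem edgeSteps_simpleEdge (g : Fin m) : edgeSteps (simpleEdge g) = {g} := by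
  ext g'
  simp only [edgeSteps, simpleEdge, Finset.mem_filter, Finset.mem_univ, true_and,
    Finset.mem_singleton, Fin.castSucc_le_castSucc_iff, Fin.succ_le_succ_iff]
  exact ⟨fun h => le_antisymm h.2 h.1, fun h => h ▸ ⟨le_rfl, le_rfl⟩⟩

theorem simpleEdge_mem_stepFlat {J : Set (Fin m)} {g : Fin m} :
    simpleEdge g ∈ stepFlat J ↔ g ∈ J := by
  change (∀ g' ∈ edgeSteps (simpleEdge g), g' ∈ J) ↔ _
  simp [edgeSteps_simpleEdge]

theorem stepFlat_injective : Function.Injective (stepFlat (m := m)) := fun J J' h => by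
  ext g
  rw [← simpleEdge_mem_stepFlat, h, simpleEdge_mem_stepFlat]

theorem simpleEdge_injective : Function.Injective (simpleEdge (m := m)) := fun g g' h => by
  have := congrArg edgeSteps h
  simpa [edgeSteps_simpleEdge] using this

/-- Telescoping. The target group is arbitrary because the identity is used both for the coordinate
functionals and for the integers i ↦ i, the latter to see that every edge has a step. -/
theorem sub_eq_sum_steps {A : Type*} [AddCommGroup A] (F : Fin (m + 1) → A) (a b : Fin (m + 1))
    (hab : a ≤ b) :
    F b - F a = ∑ g : Fin m with a ≤ g.castSucc ∧ g.succ ≤ b, (F g.succ - F g.castSucc) := by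
  induction b using Fin.induction with
  | zero =>
    obtain rfl : a = 0 := Fin.le_zero_iff.1 hab
    rw [Finset.filter_false_of_mem]
    · simp
    · rintro g - ⟨-, h⟩
      exact absurd (Fin.le_zero_iff.1 h) (Fin.succ_ne_zero g)
  | succ g ih =>
    rcases hab.eq_or_lt with rfl | hlt
    · rw [Finset.filter_false_of_mem]
      · simp
      · rintro g' - ⟨h1, h2⟩
        exact absurd (h2.trans h1) (not_le.2 Fin.castSucc_lt_succ)
    · have hle : a ≤ g.castSucc := Fin.le_castSucc_iff.2 hlt
      have : (Finset.univ.filter fun g' : Fin m => a ≤ g'.castSucc ∧ g'.succ ≤ g.succ) =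
          insert g (Finset.univ.filter fun g' : Fin m =>
            a ≤ g'.castSucc ∧ g'.succ ≤ g.castSucc) := by
        ext g'
        simp only [Finset.mem_filter, Finset.mem_univ, true_and, Finset.mem_insert,
          Fin.succ_le_succ_iff, Fin.succ_le_castSucc_iff]
        constructor
        · rintro ⟨h1, h2⟩
          exact h2.eq_or_lt.imp id fun h => ⟨h1, h⟩
        · rintro (rfl | h)
          · exact ⟨hle, le_rfl⟩
          · exact ⟨h.1, h.2.le⟩
      rw [this, Finset.sum_insert (by simp), ← ih hle]
      abel

theorem braidForm_eq_sum (e : Edge (m + 1)) :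
    braidForm (m + 1) e = ∑ g ∈ edgeSteps e, braidForm (m + 1) (simpleEdge g) :=
  sub_eq_sum_steps (fun i => (LinearMap.proj i : (Fin (m + 1) → ℝ) →ₗ[ℝ] ℝ)) e.1.1 e.1.2 e.2.le

/-- Partial sums provide a point with prescribed consecutive differences, so the forms of the simple
edges can be tested as independent coordinates. -/
theorem braidForm_simpleEdge_partialSum (t : Fin m → ℝ) (g : Fin m) :
    braidForm (m + 1) (simpleEdge g) (Fin.partialSum t) = t g := by
  simp [braidForm, simpleEdge, Fin.partialSum_succ]

theorem braidForm_partialSum (t : Fin m → ℝ) (e : Edge (m + 1)) :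
    braidForm (m + 1) e (Fin.partialSum t) = ∑ g ∈ edgeSteps e, t g := by
  rw [braidForm_eq_sum, LinearMap.sum_apply]
  exact Finset.sum_congr rfl fun g _ => braidForm_simpleEdge_partialSum t g

theorem edgeSteps_nonempty (e : Edge (m + 1)) : (edgeSteps e).Nonempty := by
  by_contra h
  have h1 := braidForm_partialSum (m := m) (fun _ => 1) e
  have h2 := sub_eq_sum_steps (fun i : Fin (m + 1) => ((i : ℕ) : ℤ)) e.1.1 e.1.2 e.2.le
  rw [show (Finset.univ.filter fun g : Fin m => e.1.1 ≤ g.castSucc ∧ g.succ ≤ e.1.2) = ∅ from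
    Finset.not_nonempty_iff_eq_empty.1 h, Finset.sum_empty, sub_eq_zero, Nat.cast_inj] at h2
  exact e.2.ne (Fin.ext h2.symm)

theorem linearIndependent_braidForm_simpleEdge :
    LinearIndependent ℝ (fun g : Fin m => braidForm (m + 1) (simpleEdge g)) := by
  rw [Fintype.linearIndependent_iff]
  intro c hc g
  have := LinearMap.congr_fun hc (Fin.partialSum (Pi.single g (1 : ℝ)))
  simpa [braidForm_simpleEdge_partialSum, Pi.single_apply] using this

theorem completeGraphMatroid_indep_iff {I : Set (Edge (m + 1))} :
    (completeGraphMatroid (m + 1)).Indep I ↔ LinearIndepOn ℝ (braidForm (m + 1)) I := Iff.rfl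

theorem indep_range_simpleEdge :
    (completeGraphMatroid (m + 1)).Indep (Set.range simpleEdge) := by
  rw [completeGraphMatroid_indep_iff, linearIndepOn_range_iff simpleEdge_injective]
  exact linearIndependent_braidForm_simpleEdge

theorem mem_ground (e : Edge (m + 1)) : e ∈ (completeGraphMatroid (m + 1)).E := Set.mem_univ e

/-- Decomposition into steps gives one inclusion. For the other, take the point z that is constant
across the steps in J and rises by 1 at every other step: the forms of J vanish at z, whereas the
form of e counts the steps of e outside J. -/
theorem closure_simpleEdge (J : Set (Fin m)) :
    (completeGraphMatroid (m + 1)).closure (simpleEdge '' J) = stepFlat J := by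
  classical
  have hJ := (indep_range_simpleEdge (m := m)).subset (Set.image_subset_range _ J)
  have hspan : ∀ e, e ∈ stepFlat J ↔
      braidForm (m + 1) e ∈ Submodule.span ℝ (braidForm (m + 1) '' (simpleEdge '' J)) := by
    intro e
    constructor
    · intro he
      rw [braidForm_eq_sum]
      exact Submodule.sum_mem _ fun g hg =>
        Submodule.subset_span ⟨_, ⟨g, he g hg, rfl⟩, rfl⟩
    · intro he g hg
      by_contra hgJ
      let z := Fin.partialSum (fun g : Fin m => if g ∈ J then (0 : ℝ) else 1)
      have h0 : ∀ φ ∈ Submodule.span ℝ (braidForm (m + 1) '' (simpleEdge '' J)), φ z = 0 := by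
        intro φ hφ
        induction hφ using Submodule.span_induction with
        | mem φ h =>
          obtain ⟨_, ⟨g, hg, rfl⟩, rfl⟩ := h
          rw [braidForm_simpleEdge_partialSum, if_pos hg]
        | zero => rfl
        | add x y _ _ hx hy => rw [LinearMap.add_apply, hx, hy, add_zero]
        | smul a x _ hx => rw [LinearMap.smul_apply, hx, smul_zero]
      have h1 := h0 _ he
      rw [braidForm_partialSum, Finset.sum_eq_zero_iff_of_nonneg
        (fun g _ => by split_ifs <;> norm_num)] at h1
      simpa [hgJ] using h1 g hg
  ext e
  rw [hspan]
  by_cases heJ : e ∈ simpleEdge '' J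
  · exact iff_of_true (Matroid.mem_closure_of_mem' _ heJ (mem_ground e))
      (Submodule.subset_span ⟨e, heJ, rfl⟩)
  · rw [← not_iff_not, hJ.notMem_closure_iff_of_notMem heJ (mem_ground e),
      completeGraphMatroid_indep_iff, linearIndepOn_insert heJ]
    exact and_iff_right hJ

theorem isFlat_stepFlat (J : Set (Fin m)) : (completeGraphMatroid (m + 1)).IsFlat (stepFlat J) := by
  rw [← closure_simpleEdge]; exact Matroid.isFlat_closure _

theorem eRk_stepFlat (J : Set (Fin m)) :
    (completeGraphMatroid (m + 1)).eRk (stepFlat J) = J.encard := by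
  rw [← closure_simpleEdge, Matroid.eRk_closure_eq,
    (indep_range_simpleEdge.subset (Set.image_subset_range _ J)).eRk_eq_encard,
    simpleEdge_injective.encard_image]

theorem completeGraphMatroid_loopless : (completeGraphMatroid (m + 1)).Loopless := by
  refine ⟨?_⟩
  have h := closure_simpleEdge (∅ : Set (Fin m))
  rw [Set.image_empty, Matroid.closure_empty] at h
  rw [h]
  ext e
  obtain ⟨g, hg⟩ := edgeSteps_nonempty e
  exact iff_of_false (fun he => he g hg) (fun he => he)

/-- Entries 0 or + mean that z is weakly increasing. Each z_j - z_i is then a sum of nonnegative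
step differences and vanishes only if all of them do, so the zero set is governed by the steps. Any
J is realised by a z that rises exactly at the steps outside J. -/
theorem mem_faceLattice_braid {F : Set (Edge (m + 1))} :
    F ∈ faceLattice (completeGraphMatroid (m + 1)) (arrangementCovectors (braidForm (m + 1)))
      (fun _ => 1) ↔ ∃ J : Set (Fin m), F = stepFlat J := by
  classical
  constructor
  · rintro ⟨_, ⟨z, rfl⟩, hz, rfl⟩
    have hnn : ∀ e, 0 ≤ braidForm (m + 1) e z := by
      intro e
      rcases hz e (mem_ground e) with h | h
      · exact (sign_eq_zero_iff.1 h).ge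
      · exact (sign_eq_one_iff.1 h).le
    refine ⟨{g | braidForm (m + 1) (simpleEdge g) z = 0}, ?_⟩
    ext e
    have h1 : e ∈ {e ∈ (completeGraphMatroid (m + 1)).E |
        SignType.sign (braidForm (m + 1) e z) = 0} ↔ braidForm (m + 1) e z = 0 :=
      ⟨fun h => sign_eq_zero_iff.1 h.2, fun h => ⟨mem_ground e, sign_eq_zero_iff.2 h⟩⟩
    rw [h1, braidForm_eq_sum, LinearMap.sum_apply,
      Finset.sum_eq_zero_iff_of_nonneg (fun g _ => hnn _)]
    rfl
  · rintro ⟨J, rfl⟩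
    let t : Fin m → ℝ := fun g => if g ∈ J then 0 else 1
    have ht : ∀ g, 0 ≤ t g := fun g => by dsimp only [t]; split_ifs <;> norm_num
    have h0 : ∀ e, braidForm (m + 1) e (Fin.partialSum t) = 0 ↔ e ∈ stepFlat J := by
      intro e
      rw [braidForm_partialSum, Finset.sum_eq_zero_iff_of_nonneg (fun g _ => ht g)]
      refine forall₂_congr fun g _ => ?_
      dsimp only [t]
      split_ifs with h <;> simp [h]
    refine ⟨_, ⟨Fin.partialSum t, rfl⟩, fun e _ => ?_, ?_⟩
    · have : 0 ≤ braidForm (m + 1) e (Fin.partialSum t) := by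
        rw [braidForm_partialSum]; exact Finset.sum_nonneg fun g _ => ht g
      rcases this.eq_or_lt with h | h
      · exact Or.inl (sign_eq_zero_iff.2 h.symm)
      · exact Or.inr (sign_eq_one_iff.2 h)
    · ext e
      rw [← h0]
      exact ⟨fun h => ⟨mem_ground e, sign_eq_zero_iff.2 h⟩, fun h => sign_eq_zero_iff.1 h.2⟩

/-- An alternating form that does not vanish on a tuple does not vanish on any tuple that spans
it. -/
theorem alternating_ne_zero_of_span {W : Type*} [AddCommGroup W] [Module ℝ W] {k : ℕ}
    (D : W [⋀^Fin k]→ₗ[ℝ] ℝ) (s v : Fin k → W) (A : Fin k → Finset (Fin k))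
    (hv : ∀ j, v j = ∑ g ∈ A j, s g) (h : D v ≠ 0) : D s ≠ 0 := by
  intro h0
  apply h
  have : v = fun j => ∑ g ∈ A j, s g := funext hv
  rw [this]
  change D.toMultilinearMap _ = 0
  rw [MultilinearMap.map_sum_finset]
  refine Finset.sum_eq_zero fun r _ => ?_
  change D (s ∘ r) = 0
  -- A choice of one summand in each argument either permutes s, giving D s up to sign, or repeats a
  -- vector, giving 0.
  by_cases hr : Function.Injective r
  · obtain ⟨σ, rfl⟩ : ∃ σ : Equiv.Perm (Fin k), r = σ :=
      ⟨Equiv.ofBijective r (Finite.injective_iff_bijective.1 hr), rfl⟩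
    rw [D.map_perm, h0, smul_zero]
  · rw [Function.not_injective_iff] at hr
    obtain ⟨i, j, hij, hne⟩ := hr
    exact D.map_eq_zero_of_eq _ (by simp [hij]) hne

theorem isSimplicialTope_braid {χ : (Fin m → Edge (m + 1)) → SignType}
    (hχ : IsArrangementChirotope (braidForm (m + 1)) m χ) :
    IsSimplicialTope (completeGraphMatroid (m + 1)) (arrangementCovectors (braidForm (m + 1))) χ
      simpleEdge := by
  obtain ⟨D, ⟨b, hb⟩, hD⟩ := hχ
  refine ⟨completeGraphMatroid_loopless, simpleEdge_injective, indep_range_simpleEdge, fun F => ?_,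
    fun v i j hij => ?_, fun v j i I e hv he he' => ?_, ?_⟩
  · simp only [mem_faceLattice_braid, closure_simpleEdge]
  · rw [hD, hD, ← Function.comp_assoc, D.map_swap _ hij, Left.sign_neg]
  · rw [closure_simpleEdge] at he he'
    have hstep : ∀ g ∈ edgeSteps e, g = i ∨ g ∈ I := he
    have hi : i ∈ edgeSteps e := by
      by_contra hi
      exact he' fun g hg => (hstep g hg).resolve_left fun h => hi (h ▸ hg)
    -- Expand the form of e in the j-th argument. A step other than i already occurs as another
    -- argument and contributes 0; step i has coefficient 1.
    rw [hD, hD, Function.comp_update, Function.comp_update, braidForm_eq_sum,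
      D.map_update_sum, Finset.sum_eq_single i _ (fun h => absurd hi h)]
    intro g hg hgi
    obtain ⟨j', hj', hvj'⟩ := hv g ((hstep g hg).resolve_left hgi)
    exact D.map_eq_zero_of_eq _ (by simp [hj', hvj']) hj'
  · rw [hD, ne_eq, sign_eq_zero_iff]
    exact alternating_ne_zero_of_span D _ _ (fun j => edgeSteps (b j))
      (fun j => braidForm_eq_sum (b j)) hb

theorem permTope_one (n : ℕ) : permTope (1 : Equiv.Perm (Fin n)) = fun _ => 1 := by
  funext p
  exact if_pos p.2

/-- The elements that come at one of the first `i` positions of `σ`. -/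
def initialSet (σ : Equiv.Perm (Fin m)) (i : Fin (m + 1)) : Set (Fin m) :=
  {g | (σ.symm g : ℕ) < i}

theorem encard_initialSet (σ : Equiv.Perm (Fin m)) (i : Fin (m + 1)) :
    (initialSet σ i).encard = ((i : ℕ) : ℕ∞) := by
  have : initialSet σ i = σ '' ((Finset.univ.filter fun k : Fin m => (k : ℕ) < i : Finset (Fin m))
      : Set (Fin m)) := by
    ext g
    simp [initialSet, Equiv.image_eq_preimage_symm]
  rw [this, σ.injective.encard_image, Set.encard_coe_eq_coe_finsetCard, Fin.card_filter_val_lt,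
    min_eq_right (Nat.lt_succ_iff.1 i.2)]

theorem initialSet_mono (σ : Equiv.Perm (Fin m)) : Monotone (initialSet σ) :=
  fun _ j hij g hg => show (σ.symm g : ℕ) < j from Nat.lt_of_lt_of_le hg hij

theorem initialSet_injective :
    Function.Injective (initialSet : Equiv.Perm (Fin m) → Fin (m + 1) → Set (Fin m)) := by
  intro σ τ h
  have key : ∀ (g : Fin m) (i : Fin (m + 1)), (σ.symm g : ℕ) < i ↔ (τ.symm g : ℕ) < i :=
    fun g i => Set.ext_iff.1 (congrFun h i) g
  refine Equiv.symm_bijective.injective (Equiv.ext fun g => Fin.ext ?_)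
  have h1 := (key g (σ.symm g).succ).1 (by simp)
  have h2 := (key g (τ.symm g).succ).2 (by simp)
  rw [Fin.val_succ] at h1 h2
  omega

/-- Each link of a chain with sizes 0, 1, ..., m adds a new element; listing these elements in order
of appearance gives σ. -/
theorem exists_initialSet_eq (J : Fin (m + 1) → Set (Fin m)) (hJ : Monotone J)
    (hcard : ∀ i, (J i).encard = ((i : ℕ) : ℕ∞)) :
    ∃ σ : Equiv.Perm (Fin m), initialSet σ = J := by
  have hex : ∀ k : Fin m, ∃ g ∈ J k.succ, g ∉ J k.castSucc := by
    intro k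
    by_contra! h
    have := Set.encard_le_encard (show J k.succ ⊆ J k.castSucc from h)
    rw [hcard, hcard, Nat.cast_le, Fin.val_succ, Fin.val_castSucc] at this
    omega
  choose u hu1 hu2 using hex
  have hinj : Function.Injective u := by
    intro k l hkl
    by_contra hne
    wlog hlt : k < l generalizing k l
    · exact this hkl.symm (Ne.symm hne) (lt_of_le_of_ne (not_lt.1 hlt) (Ne.symm hne))
    exact hu2 l (hkl ▸ hJ (Fin.succ_le_castSucc_iff.2 hlt) (hu1 k))
  let σ : Equiv.Perm (Fin m) := Equiv.ofBijective u (Finite.injective_iff_bijective.1 hinj)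
  refine ⟨σ, funext fun i => ?_⟩
  refine Set.Finite.eq_of_subset_of_encard_le (Set.toFinite _) ?_
    (by rw [hcard, encard_initialSet])
  intro g hg
  have h1 : u (σ.symm g) = g := σ.apply_symm_apply g
  rw [← h1]
  refine hJ ?_ (hu1 _)
  exact Fin.le_def.2 (by rw [Fin.val_succ]; exact hg)

/-- The amplitude as a sum over the maximal flags of faces of the tope, that is, over the orderings
of its facets. -/
theorem phi3Amplitude_eq_sum_perm {χ : (Fin m → Edge (m + 1)) → SignType}
    (hχ : IsArrangementChirotope (braidForm (m + 1)) m χ) :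
    phi3Amplitude (m + 1) χ = ∑ σ : Equiv.Perm (Fin m),
      ∏ i ∈ Finset.Ioo 0 (Fin.last m), 1 / setSum param (stepFlat (initialSet σ i)) := by
  classical
  have hS := isSimplicialTope_braid hχ
  -- The monomial only guarantees that the chosen form satisfies the recursion. Uniqueness is not
  -- needed, because `flagResidue_sq` applies to every solution.
  have hex : ∃ x : osDegree (completeGraphMatroid (m + 1)) m,
      IsCanonicalForm m (completeGraphMatroid (m + 1)) (arrangementCovectors (braidForm (m + 1))) χ
        (fun _ => 1) x := ⟨⟨_, osMk_chiMonomial_mem _ χ simpleEdge⟩, hS.isCanonicalForm_chiMonomial⟩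
  have hΩ : IsCanonicalForm m (completeGraphMatroid (m + 1))
      (arrangementCovectors (braidForm (m + 1))) χ (fun _ => 1)
      (canonicalForm m (completeGraphMatroid (m + 1)) (arrangementCovectors (braidForm (m + 1))) χ
        (fun _ => 1)) := by
    rw [canonicalForm, dif_pos hex]; exact hex.choose_spec
  change matroidAmplitude m (completeGraphMatroid (m + 1)) _ χ _ = _
  rw [permTope_one, matroidAmplitude, deRhamForm]
  generalize canonicalForm m (completeGraphMatroid (m + 1))
    (arrangementCovectors (braidForm (m + 1))) χ (fun _ => 1) = x at hΩ
  have hterm : ∀ F ∈ (Finset.univ.filter fun F : Fin (m + 1) → Set (Edge (m + 1)) =>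
      IsSaturatedFlag (completeGraphMatroid (m + 1)) m F),
      ((flagResidue m (completeGraphMatroid (m + 1)) F x : ℤ) : KinematicField (Edge (m + 1))) *
        (∏ i ∈ Finset.Ioo 0 (Fin.last m), 1 / setSum param (F i)) *
        ((flagResidue m (completeGraphMatroid (m + 1)) F x : ℤ)) =
      if ∀ i, ∃ J, F i = stepFlat J then
        ∏ i ∈ Finset.Ioo 0 (Fin.last m), 1 / setSum param (F i) else 0 := by
    intro F hF
    have h := hS.flagResidue_sq hΩ (Finset.mem_filter.1 hF).2
    simp only [mem_faceLattice_braid] at h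
    rw [mul_right_comm, ← Int.cast_mul, ← sq, h]
    split_ifs <;> simp
  rw [Finset.sum_congr (by congr) hterm, ← Finset.sum_filter, Finset.filter_filter]
  symm
  refine Finset.sum_bij (fun σ _ i => stepFlat (initialSet σ i)) ?_ ?_ ?_ ?_
  · intro σ _
    refine Finset.mem_filter.2 ⟨Finset.mem_univ _, ⟨fun i => isFlat_stepFlat _, fun i => ?_, ?_⟩,
      fun i => ⟨_, rfl⟩⟩
    · rw [eRk_stepFlat, encard_initialSet]
    · exact fun i j hij e he g hg => initialSet_mono σ hij (he g hg)
  · intro σ _ τ _ h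
    exact initialSet_injective (funext fun i => stepFlat_injective (congrFun h i))
  · intro F hF
    obtain ⟨-, hF, hJ⟩ := Finset.mem_filter.1 hF
    choose J hJ using hJ
    obtain ⟨σ, rfl⟩ := exists_initialSet_eq J
      (fun i j hij g hg => by
        rw [← simpleEdge_mem_stepFlat, ← hJ] at hg ⊢
        exact hF.monotone hij hg)
      (fun i => by rw [← eRk_stepFlat, ← hJ, hF.rank])
    exact ⟨σ, Finset.mem_univ _, (funext hJ).symm⟩
  · intros; rfl

end Braid

/-! ### Planar binary trees, gaps between leaves, and increasing trees. -/

namespace Branch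

variable {n : ℕ}

/-- The first leaf. -/
def first : Branch n → Fin n
  | leaf i => i
  | join l _ => first l

/-- The first leaf to the right of the topmost vertex. -/
def gap : Branch n → Fin n
  | leaf i => i
  | join _ r => r.first

/-- The values of `p` at the gaps increase towards the root. -/
def Increasing (p : Fin n → ℕ) : Branch n → Prop
  | leaf _ => True
  | join l r => Increasing p l ∧ Increasing p r ∧
      ∀ x ∈ l.leaves.tail ++ r.leaves.tail, p x < p r.first

/-- A gap is named by the leaf on its right, so splitting off the first leaf leaves precisely the
list of gaps of the branch. -/
theorem leaves_eq (b : Branch n) : b.leaves = b.first :: b.leaves.tail := by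
  induction b with
  | leaf i => rfl
  | join l r hl _ =>
    change l.leaves ++ r.leaves = l.first :: (l.leaves ++ r.leaves).tail
    rw [hl]; rfl

theorem leaves_join (l r : Branch n) :
    (join l r).leaves = l.leaves ++ r.first :: r.leaves.tail := by
  rw [← leaves_eq]; rfl

theorem tail_leaves_join (l r : Branch n) :
    (join l r).leaves.tail = l.leaves.tail ++ r.first :: r.leaves.tail := by
  rw [leaves_join, leaves_eq l]; rfl

theorem length_leaves_pos (b : Branch n) : 0 < b.leaves.length := by
  rw [leaves_eq]; simp

theorem mem_subbranches_self (b : Branch n) : b ∈ b.subbranches := by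
  classical
  cases b <;> simp [subbranches]

theorem mem_subbranches_join {b l r : Branch n} :
    b ∈ (join l r).subbranches ↔ b = join l r ∨ b ∈ l.subbranches ∨ b ∈ r.subbranches := by
  classical
  simp [subbranches]

theorem not_isLeaf_join (l r : Branch n) : ¬ (join l r).IsLeaf := by
  rintro ⟨i, h⟩; cases h

theorem leaves_infix {b T : Branch n} (h : b ∈ T.subbranches) : b.leaves <:+: T.leaves := by
  induction T with
  | leaf i =>
    obtain rfl : b = leaf i := by simpa [subbranches] using h
    exact List.infix_refl _
  | join l r hl hr =>
    rcases mem_subbranches_join.1 h with rfl | h | h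
    · exact List.infix_refl _
    · exact (hl h).trans (List.prefix_append _ _).isInfix
    · exact (hr h).trans (List.suffix_append _ _).isInfix

theorem eq_or_length_lt {b T : Branch n} (h : b ∈ T.subbranches) :
    b = T ∨ b.leaves.length < T.leaves.length := by
  cases T with
  | leaf i => exact Or.inl (by simpa [subbranches] using h)
  | join l r =>
    have h1 := length_leaves_pos l
    have h2 := length_leaves_pos r
    have h3 : (join l r).leaves.length = l.leaves.length + r.leaves.length :=
      List.length_append
    rcases mem_subbranches_join.1 h with rfl | h | h
    · exact Or.inl rfl
    · have := (leaves_infix h).length_le; right; omega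
    · have := (leaves_infix h).length_le; right; omega

theorem subbranches_trans {a b c : Branch n} (h : a ∈ b.subbranches) (h' : b ∈ c.subbranches) :
    a ∈ c.subbranches := by
  induction c with
  | leaf i =>
    obtain rfl : b = leaf i := by simpa [subbranches] using h'
    exact h
  | join l r hl hr =>
    rcases mem_subbranches_join.1 h' with rfl | h' | h'
    · exact h
    · exact mem_subbranches_join.2 (Or.inr (Or.inl (hl h')))
    · exact mem_subbranches_join.2 (Or.inr (Or.inr (hr h')))

theorem tail_subset {b T : Branch n} (h : b ∈ T.subbranches) :
    b.leaves.tail ⊆ T.leaves.tail := by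
  induction T with
  | leaf i =>
    obtain rfl : b = leaf i := by simpa [subbranches] using h
    exact List.Subset.refl _
  | join l r hl hr =>
    rcases mem_subbranches_join.1 h with rfl | h | h
    · exact List.Subset.refl _
    · rw [tail_leaves_join]
      exact fun x hx => List.mem_append_left _ (hl h hx)
    · rw [tail_leaves_join]
      exact fun x hx => List.mem_append_right _ (List.mem_cons_of_mem _ (hr h hx))

theorem gap_mem_tail {b : Branch n} (hb : ¬ b.IsLeaf) : b.gap ∈ b.leaves.tail := by
  cases b with
  | leaf i => exact absurd ⟨i, rfl⟩ hb
  | join l r => rw [tail_leaves_join]; exact List.mem_append_right _ List.mem_cons_self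

/-- A gap of a joined branch lies inside the left part, inside the right part, or between them; in
the last case the root sits over it. -/
theorem exists_gap_eq {T : Branch n} {x : Fin n} (hx : x ∈ T.leaves.tail) :
    ∃ b ∈ T.subbranches, ¬ b.IsLeaf ∧ b.gap = x := by
  induction T with
  | leaf i => simp [leaves] at hx
  | join l r hl hr =>
    rw [tail_leaves_join, List.mem_append, List.mem_cons] at hx
    rcases hx with hx | rfl | hx
    · obtain ⟨b, hb, h⟩ := hl hx
      exact ⟨b, mem_subbranches_join.2 (Or.inr (Or.inl hb)), h⟩
    · exact ⟨_, mem_subbranches_self _, not_isLeaf_join l r, rfl⟩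
    · obtain ⟨b, hb, h⟩ := hr hx
      exact ⟨b, mem_subbranches_join.2 (Or.inr (Or.inr hb)), h⟩

/-- The three possible locations of a gap are disjoint because the leaves are distinct, so two
vertices over the same gap lie in the same part and induction applies. -/
theorem eq_of_gap_eq {T : Branch n} (hT : T.leaves.Nodup) {b b' : Branch n}
    (hb : b ∈ T.subbranches) (hb' : b' ∈ T.subbranches) (hl : ¬ b.IsLeaf) (hl' : ¬ b'.IsLeaf)
    (h : b.gap = b'.gap) : b = b' := by
  induction T with
  | leaf i =>
    obtain rfl : b = leaf i := by simpa [subbranches] using hb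
    exact absurd ⟨i, rfl⟩ hl
  | join l r ihl ihr =>
    have hT' := hT
    rw [leaves_join, List.nodup_append] at hT'
    obtain ⟨hnl, hnr, hdisj⟩ := hT'
    have hfr : r.first ∉ r.leaves.tail := (List.nodup_cons.1 hnr).1
    rw [← leaves_eq] at hnr hdisj
    have hL : ∀ {b}, b ∈ l.subbranches → ¬ b.IsLeaf → b.gap ∈ l.leaves := fun h h' =>
      List.mem_of_mem_tail (tail_subset h (gap_mem_tail h'))
    have hR : ∀ {b}, b ∈ r.subbranches → ¬ b.IsLeaf → b.gap ∈ r.leaves.tail := fun h h' =>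
      tail_subset h (gap_mem_tail h')
    have hF : r.first ∈ r.leaves := by rw [leaves_eq]; exact List.mem_cons_self
    rcases mem_subbranches_join.1 hb with rfl | hb | hb <;>
      rcases mem_subbranches_join.1 hb' with rfl | hb' | hb'
    · rfl
    · exact absurd h.symm (hdisj _ (hL hb' hl') _ hF)
    · exact absurd ((show r.first = b'.gap from h) ▸ hR hb' hl') hfr
    · exact absurd h (hdisj _ (hL hb hl) _ hF)
    · exact ihl hnl hb hb'
    · exact absurd h (hdisj _ (hL hb hl) _ (List.mem_of_mem_tail (hR hb' hl')))
    · exact absurd ((show b.gap = r.first from h) ▸ hR hb hl) hfr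
    · exact absurd h.symm (hdisj _ (hL hb' hl') _ (List.mem_of_mem_tail (hR hb hl)))
    · exact ihr hnr hb hb'

theorem Increasing.of_mem {p : Fin n → ℕ} {b T : Branch n} (hT : T.Increasing p)
    (h : b ∈ T.subbranches) : b.Increasing p := by
  induction T with
  | leaf i =>
    obtain rfl : b = leaf i := by simpa [subbranches] using h
    exact hT
  | join l r hl hr =>
    rcases mem_subbranches_join.1 h with rfl | h | h
    · exact hT
    · exact hl hT.1 h
    · exact hr hT.2.1 h

theorem Increasing.le_gap {p : Fin n → ℕ} {T : Branch n} (hT : T.Increasing p) {x : Fin n}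
    (hx : x ∈ T.leaves.tail) : p x ≤ p T.gap := by
  cases T with
  | leaf i => simp [leaves] at hx
  | join l r =>
    rw [tail_leaves_join, List.mem_append, List.mem_cons] at hx
    rcases hx with hx | rfl | hx
    · exact (hT.2.2 x (List.mem_append_left _ hx)).le
    · exact le_rfl
    · exact (hT.2.2 x (List.mem_append_right _ hx)).le

/-- Every gap other than the root's is the gap of a proper subbranch, so it suffices to compare
nested vertices. This is the form in which compatibility of the total order with ⪯ becomes
available. -/
theorem increasing_of_lt {p : Fin n → ℕ} {T : Branch n}
    (h : ∀ b ∈ T.subbranches, ∀ b' ∈ T.subbranches, ¬ b.IsLeaf → ¬ b'.IsLeaf →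
      b ∈ b'.subbranches → b ≠ b' → p b.gap < p b'.gap) : T.Increasing p := by
  induction T with
  | leaf i => trivial
  | join l r hl hr =>
    have hl' : ∀ {b}, b ∈ l.subbranches → b ∈ (join l r).subbranches := fun h =>
      mem_subbranches_join.2 (Or.inr (Or.inl h))
    have hr' : ∀ {b}, b ∈ r.subbranches → b ∈ (join l r).subbranches := fun h =>
      mem_subbranches_join.2 (Or.inr (Or.inr h))
    refine ⟨hl fun b hb b' hb' => h b (hl' hb) b' (hl' hb'),
      hr fun b hb b' hb' => h b (hr' hb) b' (hr' hb'), fun x hx => ?_⟩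
    have h1 := length_leaves_pos l
    have h2 := length_leaves_pos r
    have h3 : (join l r).leaves.length = l.leaves.length + r.leaves.length :=
      List.length_append
    rcases List.mem_append.1 hx with hx | hx
    · obtain ⟨b, hb, hbl, rfl⟩ := exists_gap_eq hx
      refine h b (hl' hb) _ (mem_subbranches_self _) hbl (not_isLeaf_join l r) (hl' hb) ?_
      rintro rfl
      have := (leaves_infix hb).length_le
      omega
    · obtain ⟨b, hb, hbl, rfl⟩ := exists_gap_eq hx
      refine h b (hr' hb) _ (mem_subbranches_self _) hbl (not_isLeaf_join l r) (hr' hb) ?_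
      rintro rfl
      have := (leaves_infix hb).length_le
      omega

/-- The root gap is the only gap where p is largest, so both trees cut the leaf list at the same
place and their two parts agree by induction. Strictness in `Increasing` makes injectivity of p
unnecessary here. -/
theorem Increasing.eq_of_leaves_eq {p : Fin n → ℕ} {T T' : Branch n} (hT : T.Increasing p)
    (hT' : T'.Increasing p) (hn : T.leaves.Nodup) (h : T.leaves = T'.leaves) : T = T' := by
  have hlen : ∀ l r : Branch n, ∀ i, [i] ≠ (join l r).leaves := by
    intro l r i h
    have h1 := length_leaves_pos l
    have h2 := length_leaves_pos r
    have h3 : (join l r).leaves.length = l.leaves.length + r.leaves.length :=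
      List.length_append
    rw [← h, List.length_singleton] at h3
    omega
  induction T generalizing T' with
  | leaf i =>
    cases T' with
    | leaf j => simpa [leaves] using h
    | join l r => exact absurd h (hlen l r i)
  | join l r hl hr =>
    cases T' with
    | leaf j => exact absurd h.symm (hlen l r j)
    | join l' r' =>
      have hmax : ∀ {l r l' r' : Branch n}, (join l r).Increasing p →
          (join l r).leaves = (join l' r').leaves → r'.first = r.first ∨
            p r'.first < p r.first := by
        intro l r l' r' hI h
        have hm : r'.first ∈ (join l r).leaves.tail := by
          rw [h, tail_leaves_join]; exact List.mem_append_right _ List.mem_cons_self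
        rw [tail_leaves_join, List.mem_append, List.mem_cons] at hm
        rcases hm with hm | hm | hm
        · exact Or.inr (hI.2.2 _ (List.mem_append_left _ hm))
        · exact Or.inl hm
        · exact Or.inr (hI.2.2 _ (List.mem_append_right _ hm))
      have hfirst : r'.first = r.first := by
        rcases hmax hT h with h1 | h1
        · exact h1
        · rcases hmax hT' h.symm with h2 | h2
          · exact h2.symm
          · omega
      rw [leaves_join, List.nodup_append] at hn
      have hsplit := h
      rw [leaves_join, leaves_join, hfirst, List.append_cons_inj_of_notMem] at hsplit
      · obtain ⟨h1, -, h2⟩ := hsplit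
        have e1 : l = l' := hl hT.1 hT'.1 hn.1 h1
        have e2 : r = r' := by
          refine hr hT.2.1 hT'.2.1 ?_ ?_
          · rw [leaves_eq]; exact hn.2.1
          · rw [leaves_eq, leaves_eq r', hfirst, h2]
        rw [e1, e2]
      · exact fun hm => hn.2.2 _ hm _ List.mem_cons_self rfl
      · exact (List.nodup_cons.1 hn.2.1).1

/-- Cut the list at the gap where p is largest and recurse on both pieces; injectivity of p on the
gaps makes this maximum strict. -/
theorem exists_increasing (p : Fin n → ℕ) (k : ℕ) : ∀ w : List (Fin n), w.length = k → w ≠ [] →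
    w.Nodup → Set.InjOn p {x | x ∈ w.tail} → ∃ T : Branch n, T.leaves = w ∧ T.Increasing p := by
  classical
  induction k using Nat.strong_induction_on with
  | _ k ih =>
    rintro (_ | ⟨a, w⟩) hk hw hn hp
    · exact absurd rfl hw
    rcases eq_or_ne w [] with rfl | hne
    · exact ⟨leaf a, rfl, trivial⟩
    obtain ⟨x, hx, hmax⟩ := w.toFinset.exists_max_image p (List.toFinset_nonempty_iff w |>.2 hne)
    rw [List.mem_toFinset] at hx
    obtain ⟨s, t, rfl⟩ := List.append_of_mem hx
    rw [← List.cons_append, List.nodup_append] at hn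
    obtain ⟨hn1, hn2, hdisj⟩ := hn
    simp only [List.length_cons, List.length_append] at hk
    obtain ⟨l, hl, hIl⟩ := ih (s.length + 1) (by omega) (a :: s) rfl (by simp) hn1
      (hp.mono fun y hy => List.mem_append_left _ hy)
    obtain ⟨r, hr, hIr⟩ := ih (t.length + 1) (by omega) (x :: t) rfl (by simp) hn2
      (hp.mono fun y hy => List.mem_append_right _ (List.mem_cons_of_mem _ hy))
    have hfirst : r.first = x := by
      have := leaves_eq r
      rw [hr] at this
      exact (List.cons.inj this).1.symm
    refine ⟨join l r, ?_, hIl, hIr, fun y hy => ?_⟩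
    · change l.leaves ++ r.leaves = _
      rw [hl, hr]; rfl
    · rw [hl, hr, List.tail_cons, List.tail_cons, List.mem_append] at hy
      have hyw : y ∈ s ++ x :: t := by
        rcases hy with hy | hy
        · exact List.mem_append_left _ hy
        · exact List.mem_append_right _ (List.mem_cons_of_mem _ hy)
      have hyx : y ≠ x := by
        rintro rfl
        rcases hy with hy | hy
        · exact hdisj _ (List.mem_cons_of_mem _ hy) _ List.mem_cons_self rfl
        · exact (List.nodup_cons.1 hn2).1 hy
      rw [hfirst]
      exact lt_of_le_of_ne (hmax y (List.mem_toFinset.2 hyw))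
        fun h => hyx (hp hyw hx h)

/-- The branch b is rooted at the vertex where the paths from i and j meet, with i on its left and j
on its right. -/
theorem exists_join_of_lt {T : Branch n} (hT : T.leaves.Pairwise (· < ·)) {i j : Fin n}
    (hi : i ∈ T.leaves) (hj : j ∈ T.leaves) (hij : i < j) :
    ∃ b ∈ T.subbranches, ¬ b.IsLeaf ∧ i ∈ b.leaves ∧ j ∈ b.leaves ∧ i < b.gap ∧ b.gap ≤ j := by
  induction T with
  | leaf a =>
    simp only [leaves, List.mem_singleton] at hi hj
    exact absurd (hi.trans hj.symm) hij.ne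
  | join l r hl hr =>
    have hT' := hT
    change (l.leaves ++ r.leaves).Pairwise (· < ·) at hT'
    obtain ⟨h1, h2, h3⟩ := List.pairwise_append.1 hT'
    have hfr : r.first ∈ r.leaves := by rw [leaves_eq]; exact List.mem_cons_self
    rcases List.mem_append.1 (show i ∈ l.leaves ++ r.leaves from hi) with hil | hir <;>
      rcases List.mem_append.1 (show j ∈ l.leaves ++ r.leaves from hj) with hjl | hjr
    · obtain ⟨b, hb, h⟩ := hl h1 hil hjl
      exact ⟨b, mem_subbranches_join.2 (Or.inr (Or.inl hb)), h⟩
    · refine ⟨_, mem_subbranches_self _, not_isLeaf_join l r, hi, hj, h3 _ hil _ hfr, ?_⟩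
      change r.first ≤ j
      rw [leaves_eq] at hjr h2
      rcases List.mem_cons.1 hjr with rfl | hjr
      · exact le_rfl
      · exact ((List.pairwise_cons.1 h2).1 _ hjr).le
    · exact absurd (h3 _ hjl _ hir) hij.not_gt
    · obtain ⟨b, hb, h⟩ := hr h2 hir hjr
      exact ⟨b, mem_subbranches_join.2 (Or.inr (Or.inr hb)), h⟩

/-- The leaves of the subbranches of a planar tree form intervals. -/
theorem mem_tail_of_between {T b : Branch n} (hT : T.leaves = List.finRange n)
    (hb : b ∈ T.subbranches) {i j g : Fin n} (hi : i ∈ b.leaves) (hj : j ∈ b.leaves)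
    (hig : i < g) (hgj : g ≤ j) : g ∈ b.leaves.tail := by
  obtain ⟨s, t, hst⟩ := leaves_infix hb
  have hg : g ∈ s ++ b.leaves ++ t := by rw [hst, hT]; exact List.mem_finRange g
  have hs : (s ++ b.leaves ++ t).Pairwise (· < ·) := by
    rw [hst, hT]; exact List.pairwise_lt_finRange n
  obtain ⟨h1, -, h2⟩ := List.pairwise_append.1 hs
  obtain ⟨-, h3, h4⟩ := List.pairwise_append.1 h1
  have hgb : g ∈ b.leaves := by
    rcases List.mem_append.1 hg with hg | hg
    · rcases List.mem_append.1 hg with hg | hg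
      · exact absurd (h4 _ hg _ hi) hig.not_gt
      · exact hg
    · exact absurd (h2 _ (List.mem_append_right _ hj) _ hg) hgj.not_gt
  rw [leaves_eq] at hgb hi h3
  rcases List.mem_cons.1 hgb with rfl | hgb
  · rcases List.mem_cons.1 hi with rfl | hi
    · exact absurd hig (lt_irrefl _)
    · exact absurd ((List.pairwise_cons.1 h3).1 _ hi) hig.not_gt
  · exact hgb

end Branch

/-! ### Temporal Feynman diagrams as permutations of the gaps. -/

section TemporalDiagrams

variable {m : ℕ}

/-- The position of a gap between consecutive leaves in the ordering given by `σ`, as a function of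
the leaf to the right of the gap. -/
def gapPosition (σ : Equiv.Perm (Fin m)) : Fin (m + 1) → ℕ :=
  Fin.cases 0 (fun g => (σ.symm g : ℕ))

@[simp] theorem gapPosition_succ (σ : Equiv.Perm (Fin m)) (g : Fin m) :
    gapPosition σ g.succ = (σ.symm g : ℕ) := rfl

theorem mem_tail_finRange {x : Fin (m + 1)} :
    x ∈ (List.finRange (m + 1)).tail ↔ ∃ g : Fin m, g.succ = x := by
  simp [List.finRange_succ]

theorem gapPosition_injOn (σ : Equiv.Perm (Fin m)) :
    Set.InjOn (gapPosition σ) {x | x ∈ (List.finRange (m + 1)).tail} := by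
  intro x hx y hy h
  obtain ⟨g, rfl⟩ := mem_tail_finRange.1 hx
  obtain ⟨g', rfl⟩ := mem_tail_finRange.1 hy
  exact congrArg _ (σ.symm.injective (Fin.ext h))

namespace CubicPlanarTree

theorem mem_internalEdges {T : CubicPlanarTree m} {b : Branch m} :
    b ∈ T.internalEdges ↔ b ∈ T.1.subbranches ∧ ¬ b.IsLeaf ∧ b ≠ T.1 := by
  classical
  simp [internalEdges]

theorem nodup_leaves (T : CubicPlanarTree m) : T.1.leaves.Nodup := by
  rw [T.2]; exact List.nodup_finRange m

theorem not_isLeaf (hm : 0 < m) (T : CubicPlanarTree (m + 1)) : ¬ T.1.IsLeaf := by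
  rintro ⟨i, hi⟩
  have h := congrArg List.length T.2
  rw [hi, List.length_finRange] at h
  change 1 = m + 1 at h
  omega

theorem exists_succ_eq_gap {T : CubicPlanarTree (m + 1)} {b : Branch (m + 1)}
    (hb : b ∈ T.1.subbranches) (hl : ¬ b.IsLeaf) : ∃ g : Fin m, g.succ = b.gap := by
  have := Branch.tail_subset hb (Branch.gap_mem_tail hl)
  rw [T.2] at this
  exact mem_tail_finRange.1 this

theorem exists_gap_eq_succ (T : CubicPlanarTree (m + 1)) (g : Fin m) :
    ∃ b ∈ T.1.subbranches, ¬ b.IsLeaf ∧ b.gap = g.succ :=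
  Branch.exists_gap_eq (by rw [T.2]; exact mem_tail_finRange.2 ⟨g, rfl⟩)

theorem eq_of_gapPosition_eq {T : CubicPlanarTree (m + 1)} (σ : Equiv.Perm (Fin m))
    {b b' : Branch (m + 1)} (hb : b ∈ T.1.subbranches) (hb' : b' ∈ T.1.subbranches)
    (hl : ¬ b.IsLeaf) (hl' : ¬ b'.IsLeaf) (h : gapPosition σ b.gap = gapPosition σ b'.gap) :
    b = b' := by
  refine Branch.eq_of_gap_eq T.nodup_leaves hb hb' hl hl' (gapPosition_injOn σ ?_ ?_ h)
  · exact mem_tail_finRange.2 (exists_succ_eq_gap hb hl)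
  · exact mem_tail_finRange.2 (exists_succ_eq_gap hb' hl')

/-- The root carries the last gap, strictly, since different vertices have different gaps.
Positivity of m ensures that the root is a vertex and not a leaf. -/
theorem gapPosition_lt_root {T : CubicPlanarTree (m + 1)} {σ : Equiv.Perm (Fin m)} (hm : 0 < m)
    (hT : T.1.Increasing (gapPosition σ)) (e : T.internalEdges) :
    gapPosition σ e.1.gap < gapPosition σ T.1.gap := by
  obtain ⟨h1, h2, h3⟩ := mem_internalEdges.1 e.2
  refine lt_of_le_of_ne (hT.le_gap (Branch.tail_subset h1 (Branch.gap_mem_tail h2))) fun h => h3 ?_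
  exact eq_of_gapPosition_eq σ h1 (Branch.mem_subbranches_self _) h2 (not_isLeaf hm T) h

/-- Among the edges of S above e choose one with the most leaves; anything properly above it would
have more. -/
theorem exists_maximal_edge {T : CubicPlanarTree m} (S : Set T.internalEdges)
    {e : T.internalEdges} (he : e ∈ S) :
    ∃ e' ∈ S, edgeLE e e' ∧ ∀ e'' ∈ S, edgeLE e' e'' → e'' = e' := by
  classical
  obtain ⟨e', he', hmax⟩ := Set.exists_max_image {e' ∈ S | edgeLE e e'}
    (fun e' => e'.1.leaves.length) (Set.toFinite _) ⟨e, he, Branch.mem_subbranches_self _⟩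
  refine ⟨e', he'.1, he'.2, fun e'' he'' hle => ?_⟩
  rcases Branch.eq_or_length_lt hle with h | h
  · exact Subtype.ext h.symm
  · exact absurd (hmax e'' ⟨he'', Branch.subbranches_trans he'.2 hle⟩) (not_le.2 h)

end CubicPlanarTree

open CubicPlanarTree

namespace TemporalFeynmanDiagram

/-- The ordering `σ` of the gaps between consecutive leaves is the one given by the total order of
the internal edges, followed by the root. -/
structure Compatible (D : TemporalFeynmanDiagram (m + 1)) (σ : Equiv.Perm (Fin m)) : Prop where
  increasing : D.tree.1.Increasing (gapPosition σ)
  le_iff : ∀ e e', D.le e e' ↔ gapPosition σ e.1.gap ≤ gapPosition σ e'.1.gap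

/-- Take the increasing tree of σ and order its internal edges by the positions of their gaps; being
increasing is what makes this order extend ⪯. -/
theorem exists_compatible_diagram (σ : Equiv.Perm (Fin m)) :
    ∃ D : TemporalFeynmanDiagram (m + 1), D.Compatible σ := by
  obtain ⟨T, hT, hI⟩ := Branch.exists_increasing (gapPosition σ) _ (List.finRange (m + 1)) rfl
    (by simp) (List.nodup_finRange _) (gapPosition_injOn σ)
  refine ⟨⟨⟨T, hT⟩, fun e e' => gapPosition σ e.1.gap ≤ gapPosition σ e'.1.gap, ?_, ?_⟩, hI,
    fun e e' => Iff.rfl⟩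
  · exact
      { refl := fun e => le_rfl
        trans := fun a b c h h' => h.trans h'
        antisymm := fun a b h h' => by
          obtain ⟨h1, h2, -⟩ := mem_internalEdges.1 a.2
          obtain ⟨h3, h4, -⟩ := mem_internalEdges.1 b.2
          exact Subtype.ext (eq_of_gapPosition_eq σ h1 h3 h2 h4 (le_antisymm h h'))
        total := fun a b => le_total _ _ }
  · intro e e' h
    obtain ⟨h1, h2, -⟩ := mem_internalEdges.1 e.2
    obtain ⟨h3, -, -⟩ := mem_internalEdges.1 e'.2
    exact (hI.of_mem h3).le_gap (Branch.tail_subset h (Branch.gap_mem_tail h2))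

theorem Compatible.eq {D D' : TemporalFeynmanDiagram (m + 1)} {σ : Equiv.Perm (Fin m)}
    (h : D.Compatible σ) (h' : D'.Compatible σ) : D = D' := by
  obtain ⟨T, le, h1, h2⟩ := D
  obtain ⟨T', le', h1', h2'⟩ := D'
  obtain rfl : T = T' := Subtype.ext (h.increasing.eq_of_leaves_eq h'.increasing T.nodup_leaves
    (T.2.trans T'.2.symm))
  obtain rfl : le = le' := by
    funext e e'
    exact propext ((h.le_iff e e').trans (h'.le_iff e e').symm)
  rfl

/-- Both permutations order the gaps alike: gaps of internal edges by the order of the diagram, and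
the root gap last. So τ⁻¹σ is an order automorphism of `Fin m`, which can only be the identity. -/
theorem Compatible.perm_eq (hm : 0 < m) {D : TemporalFeynmanDiagram (m + 1)}
    {σ τ : Equiv.Perm (Fin m)} (h : D.Compatible σ) (h' : D.Compatible τ) : σ = τ := by
  have key : ∀ g g' : Fin m, σ.symm g ≤ σ.symm g' ↔ τ.symm g ≤ τ.symm g' := by
    intro g g'
    obtain ⟨b, hb, hl, hg⟩ := D.tree.exists_gap_eq_succ g
    obtain ⟨b', hb', hl', hg'⟩ := D.tree.exists_gap_eq_succ g'
    rw [Fin.le_def, Fin.le_def, ← gapPosition_succ, ← gapPosition_succ, ← gapPosition_succ,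
      ← gapPosition_succ, ← hg, ← hg']
    by_cases hbT' : b' = D.tree.1
    · subst hbT'
      have hx := Branch.tail_subset hb (Branch.gap_mem_tail hl)
      exact iff_of_true (h.increasing.le_gap hx) (h'.increasing.le_gap hx)
    · have he' : b' ∈ D.tree.internalEdges := mem_internalEdges.2 ⟨hb', hl', hbT'⟩
      by_cases hbT : b = D.tree.1
      · subst hbT
        exact iff_of_false (gapPosition_lt_root hm h.increasing ⟨b', he'⟩).not_ge
          (gapPosition_lt_root hm h'.increasing ⟨b', he'⟩).not_ge
      · have he : b ∈ D.tree.internalEdges := mem_internalEdges.2 ⟨hb, hl, hbT⟩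
        exact (h.le_iff ⟨b, he⟩ ⟨b', he'⟩).symm.trans (h'.le_iff ⟨b, he⟩ ⟨b', he'⟩)
  let o : Fin m ≃o Fin m := ⟨σ.trans τ.symm, fun {a b} => by
    have := key (σ a) (σ b)
    simpa using this.symm⟩
  have ho : o = OrderIso.refl _ := Subsingleton.elim _ _
  ext k
  have : τ.symm (σ k) = k := DFunLike.congr_fun ho k
  rw [← this, Equiv.apply_symm_apply, this]

/-- The vertices are the internal edges together with the root, modelled by adjoining ⊤ to the
ordered set of edges. They are in bijection with the gaps, and σ sends k to the gap of the k-th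
vertex. -/
theorem exists_compatible_perm (hm : 0 < m) (D : TemporalFeynmanDiagram (m + 1)) :
    ∃ σ : Equiv.Perm (Fin m), D.Compatible σ := by
  classical
  have := D.isLinearOrder
  let _ : LinearOrder D.tree.internalEdges :=
    { le := D.le
      le_refl := this.refl
      le_trans := this.trans
      le_antisymm := this.antisymm
      le_total := this.total
      toDecidableLE := Classical.decRel _ }
  let node : WithTop D.tree.internalEdges → Branch (m + 1) := WithTop.recTopCoe D.tree.1 (·.1)
  have hnode : ∀ x, node x ∈ D.tree.1.subbranches ∧ ¬ (node x).IsLeaf := by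
    intro x
    induction x using WithTop.recTopCoe with
    | top => exact ⟨Branch.mem_subbranches_self _, not_isLeaf hm D.tree⟩
    | coe e => exact ⟨(mem_internalEdges.1 e.2).1, (mem_internalEdges.1 e.2).2.1⟩
  have hnode_inj : Function.Injective node := by
    intro x y h
    induction x using WithTop.recTopCoe with
    | top =>
      induction y using WithTop.recTopCoe with
      | top => rfl
      | coe e => exact absurd h.symm (mem_internalEdges.1 e.2).2.2
    | coe e =>
      induction y using WithTop.recTopCoe with
      | top => exact absurd h (mem_internalEdges.1 e.2).2.2
      | coe e' => exact congrArg _ (Subtype.ext h)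
  choose γ hγ using fun x => exists_succ_eq_gap (hnode x).1 (hnode x).2
  have hγ_bij : Function.Bijective γ := by
    constructor
    · intro x y h
      refine hnode_inj (Branch.eq_of_gap_eq D.tree.nodup_leaves (hnode x).1 (hnode y).1
        (hnode x).2 (hnode y).2 ?_)
      rw [← hγ, ← hγ, h]
    · intro g
      obtain ⟨b, hb, hl, hg⟩ := D.tree.exists_gap_eq_succ g
      obtain ⟨x, rfl⟩ : ∃ x, node x = b := by
        by_cases hbT : b = D.tree.1
        · exact ⟨⊤, hbT.symm⟩
        · exact ⟨((⟨b, mem_internalEdges.2 ⟨hb, hl, hbT⟩⟩ : D.tree.internalEdges) :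
            WithTop D.tree.internalEdges), rfl⟩
      exact ⟨x, Fin.succ_injective _ ((hγ x).trans hg)⟩
  let _ : Fintype (WithTop D.tree.internalEdges) := Fintype.ofBijective _
    (Equiv.ofBijective γ hγ_bij).symm.bijective
  let o := Fintype.orderIsoFinOfCardEq (WithTop D.tree.internalEdges)
    ((Fintype.card_of_bijective hγ_bij).trans (Fintype.card_fin m))
  have hpos : ∀ x, gapPosition (o.toEquiv.trans (Equiv.ofBijective γ hγ_bij)) (node x).gap =
      (o.symm x : ℕ) := by
    intro x
    rw [← hγ, gapPosition_succ]
    change ((o.symm ((Equiv.ofBijective γ hγ_bij).symm (Equiv.ofBijective γ hγ_bij x)) : Fin m) : ℕ)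
      = _
    rw [Equiv.symm_apply_apply]
  have hle : ∀ x y, gapPosition (o.toEquiv.trans (Equiv.ofBijective γ hγ_bij)) (node x).gap ≤
      gapPosition (o.toEquiv.trans (Equiv.ofBijective γ hγ_bij)) (node y).gap ↔ x ≤ y := by
    intro x y
    rw [hpos, hpos, ← Fin.le_def, o.symm.le_iff_le]
  refine ⟨o.toEquiv.trans (Equiv.ofBijective γ hγ_bij), ?_, fun e e' => ?_⟩
  · refine Branch.increasing_of_lt fun b hb b' hb' hl hl' hbb' hne => ?_
    rw [← not_le]
    by_cases hbT : b = D.tree.1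
    · subst hbT
      rcases Branch.eq_or_length_lt hbb' with h | h
      · exact absurd h hne
      · exact absurd (Branch.leaves_infix hb').length_le (not_le.2 h)
    · let e : D.tree.internalEdges := ⟨b, mem_internalEdges.2 ⟨hb, hl, hbT⟩⟩
      by_cases hbT' : b' = D.tree.1
      · subst hbT'
        refine (hle ⊤ (e : WithTop D.tree.internalEdges)).not.2 ?_
        simp
      · let e' : D.tree.internalEdges := ⟨b', mem_internalEdges.2 ⟨hb', hl', hbT'⟩⟩
        refine (hle (e' : WithTop D.tree.internalEdges) (e : WithTop D.tree.internalEdges)).not.2 ?_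
        rw [WithTop.coe_le_coe]
        intro h
        have h2 : e ≤ e' := D.le_of_edgeLE e e' hbb'
        exact hne (congrArg Subtype.val (le_antisymm h2 h))
  · refine Iff.symm ((hle (e : WithTop D.tree.internalEdges)
      (e' : WithTop D.tree.internalEdges)).trans ?_)
    rw [WithTop.coe_le_coe]
    rfl

/-- If both endpoints of p lie in a branch e' ≤ e, so do all gaps between them, and these are not
later than e'. Conversely, the vertex where the endpoints meet has its gap between them, hence is
not later than e. It is therefore not the root, and a maximal edge above it lies in D(e). The shift
by 1 matches `initialSet`, which takes the positions strictly below its index. -/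
theorem Compatible.mem_temporalFlat (hm : 0 < m) {D : TemporalFeynmanDiagram (m + 1)}
    {σ : Equiv.Perm (Fin m)} (h : D.Compatible σ) (e : D.tree.internalEdges)
    (p : Edge (m + 1)) : p ∈ D.temporalFlat e ↔
      ∀ g ∈ edgeSteps p, (σ.symm g : ℕ) < gapPosition σ e.1.gap + 1 := by
  classical
  simp only [temporalFlat, maximalEdges, Finset.mem_biUnion, Finset.mem_filter, Finset.mem_univ,
    true_and, edgeFlat, leafSet, List.mem_toFinset, edgeSteps, Order.lt_add_one_iff]
  constructor
  · rintro ⟨e', ⟨he', -⟩, h1, h2⟩ g ⟨hg1, hg2⟩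
    have hg := Branch.mem_tail_of_between D.tree.2 (mem_internalEdges.1 e'.2).1 h1 h2
      (Fin.le_castSucc_iff.1 hg1) hg2
    exact ((h.increasing.of_mem (mem_internalEdges.1 e'.2).1).le_gap hg).trans
      ((h.le_iff e' e).1 he')
  · intro hp
    obtain ⟨b, hb, hl, h1, h2, h3, h4⟩ := Branch.exists_join_of_lt
      (by rw [D.tree.2]; exact List.pairwise_lt_finRange _)
      (by rw [D.tree.2]; exact List.mem_finRange _)
      (by rw [D.tree.2]; exact List.mem_finRange _) p.2
    obtain ⟨g, hg⟩ := exists_succ_eq_gap hb hl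
    rw [← hg] at h3 h4
    have hpos := hp g ⟨Fin.le_castSucc_iff.2 h3, h4⟩
    rw [← gapPosition_succ, hg] at hpos
    have hbT : b ≠ D.tree.1 := by
      rintro rfl
      exact absurd hpos (not_le.2 (gapPosition_lt_root hm h.increasing e))
    let e₀ : D.tree.internalEdges := ⟨b, mem_internalEdges.2 ⟨hb, hl, hbT⟩⟩
    obtain ⟨e', he', hle, hmax⟩ := exists_maximal_edge {e' | D.le e' e} (e := e₀)
      ((h.le_iff _ _).2 hpos)
    exact ⟨e', ⟨he', hmax⟩, (Branch.leaves_infix hle).subset h1,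
      (Branch.leaves_infix hle).subset h2⟩

/-- The edge at position k, counted from 0, corresponds to the flat of index k + 1. The root, at
position m - 1, would give index m, the full ground set, which the product omits. -/
theorem Compatible.prod_eq (hm : 0 < m) {D : TemporalFeynmanDiagram (m + 1)}
    {σ : Equiv.Perm (Fin m)} (h : D.Compatible σ) :
    ∏ e : D.tree.internalEdges, 1 / D.temporalPropagator e =
      ∏ i ∈ Finset.Ioo 0 (Fin.last m), 1 / setSum param (stepFlat (initialSet σ i)) := by
  classical
  obtain ⟨r, hr⟩ := exists_succ_eq_gap (Branch.mem_subbranches_self _) (not_isLeaf hm D.tree)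
  have hlt : ∀ e : D.tree.internalEdges, gapPosition σ e.1.gap + 1 < m := fun e => by
    have := gapPosition_lt_root hm h.increasing e
    rw [← hr, gapPosition_succ] at this
    have := (σ.symm r).2
    omega
  refine Finset.prod_bij
    (fun e _ => (⟨gapPosition σ e.1.gap + 1, (hlt e).trans (Nat.lt_succ_self m)⟩ : Fin (m + 1)))
    ?_ ?_ ?_ ?_
  · intro e _
    exact Finset.mem_Ioo.2 ⟨Fin.lt_def.2 (Nat.succ_pos _), Fin.lt_def.2 (hlt e)⟩
  · intro e _ e' _ he
    obtain ⟨h1, h2, -⟩ := mem_internalEdges.1 e.2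
    obtain ⟨h3, h4, -⟩ := mem_internalEdges.1 e'.2
    refine Subtype.ext (eq_of_gapPosition_eq σ h1 h3 h2 h4 ?_)
    simpa using he
  · intro i hi
    obtain ⟨hi0, him⟩ := Finset.mem_Ioo.1 hi
    rw [Fin.lt_def, Fin.val_zero] at hi0
    rw [Fin.lt_def, Fin.val_last] at him
    let k : Fin m := ⟨i - 1, by omega⟩
    obtain ⟨b, hb, hl, hg⟩ := D.tree.exists_gap_eq_succ (σ k)
    have hpos : gapPosition σ b.gap = i - 1 := by
      rw [hg, gapPosition_succ, Equiv.symm_apply_apply]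
    have hbT : b ≠ D.tree.1 := by
      rintro rfl
      -- If the vertex at position i - 1 were the root, then the gap at position m - 1 could not
      -- come later, contradicting i < m.
      have hx : (σ ⟨m - 1, by omega⟩).succ ∈ D.tree.1.leaves.tail := by
        rw [D.tree.2]; exact mem_tail_finRange.2 ⟨_, rfl⟩
      have := h.increasing.le_gap hx
      rw [hpos, gapPosition_succ, Equiv.symm_apply_apply] at this
      change m - 1 ≤ (i : ℕ) - 1 at this
      omega
    exact ⟨⟨b, mem_internalEdges.2 ⟨hb, hl, hbT⟩⟩, Finset.mem_univ _,
      Fin.ext (by change gapPosition σ b.gap + 1 = i; omega)⟩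
  · intro e _
    congr 1
    rw [temporalPropagator, setSum]
    refine Finset.sum_congr ?_ fun _ _ => rfl
    ext p
    rw [h.mem_temporalFlat hm, Finset.mem_filter, and_iff_right (Finset.mem_univ _)]
    rfl

end TemporalFeynmanDiagram

open TemporalFeynmanDiagram in
/-- The sum over temporal Feynman diagrams, as a sum over permutations. -/
theorem sum_temporalFeynmanDiagram_eq_sum_perm (hm : 0 < m) :
    ∑ D : TemporalFeynmanDiagram (m + 1), ∏ e : D.tree.internalEdges, 1 / D.temporalPropagator e =
      ∑ σ : Equiv.Perm (Fin m),
        ∏ i ∈ Finset.Ioo 0 (Fin.last m), 1 / setSum param (stepFlat (initialSet σ i)) := by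
  choose s hs using exists_compatible_perm hm
  refine Finset.sum_bij (fun D _ => s D) (fun _ _ => Finset.mem_univ _) ?_ ?_ ?_
  · intro D _ D' _ h
    exact (hs D).eq (h ▸ hs D')
  · intro σ _
    obtain ⟨D, hD⟩ := exists_compatible_diagram σ
    exact ⟨D, Finset.mem_univ _, (hs D).perm_eq hm hD⟩
  · intro D _
    exact (hs D).prod_eq hm

end TemporalDiagrams

end MatroidAmplitude

open MatroidAmplitude in
theorem mainTheorem11 (n : ℕ) (hn : 2 ≤ n) (χ : (Fin (n - 1) → Edge n) → SignType)
    (hχ : IsArrangementChirotope (braidForm n) (n - 1) χ) :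
    phi3Amplitude n χ =
      ∑ D : TemporalFeynmanDiagram n, ∏ e : D.tree.internalEdges, 1 / D.temporalPropagator e := by
  obtain ⟨m, rfl⟩ : ∃ m, n = m + 1 := ⟨n - 1, by omega⟩
  rw [sum_temporalFeynmanDiagram_eq_sum_perm (by omega)]
  exact phi3Amplitude_eq_sum_perm hχ
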